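/- Let $d+m\ge 1$ and let $\mathcal A_1,\dots,\mathcal A_n\in\mathbb R^{p_1\times\cdots\times p_d}$. Define the linear map $\mathscr A:\mathbb R^{p_1\times\cdots\times p_{d+m}}\to\mathbb R^{n\times p_{d+1}\times\cdots\times p_{d+m}}$ by $$\mathscr A(\mathcal X)_{[i,j_1,\dots,j_m]}=\sum_{k_1,\dots,k_d}\mathcal A_{i[k_1,\dots,k_d]}\,\mathcal X_{[k_1,\dots,k_d,j_1,\dots,j_m]},$$ and let $\mathcal Y=\mathscr A(\mathcal X^*)+\mathcal E$. Write $\mathcal M_k$ for the mode-$k$ matricization and $\mathcal T_k$ for its inverse, $\sigma_j$ for the $j$-th largest singular value, $\mathrm{Tucrank}(\mathcal X)=(\mathrm{rank}\,\mathcal M_k(\mathcal X))_{k=1}^{d+m}$, and $P_U=UU^\top$. Suppose $\mathrm{Tucrank}(\mathcal X^*)=\mathbf r^*$ with $r^*_k\ge 1$ for all $k$, let $\mathbf r\ge\mathbf r^*$ entrywise, and put $\underline\lambda=\min_{k}\sigma_{r_k^*}(\mathcal M_k(\mathcal X^*))$. For a tuple $\mathbf q$ let $R_{\mathbf q}$ be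 the smallest number with $(1-R_{\mathbf q})\|\mathcal Z\|_F^2\le\|\mathscr A(\mathcal Z)\|_F^2\le(1+R_{\mathbf q})\|\mathcal Z\|_F^2$ for all $\mathcal Z$ of Tucker rank at most $\mathbf q$, and let $\mathcal Z_{\max(\mathbf q)}$ be a best Frobenius-norm approximation of $\mathcal Z$ by a tensor of Tucker rank at most $\mathbf q$. Riemannian gradient descent (RGD) with input rank $\mathbf r$ starts at some $\mathcal X^0$ of Tucker rank $\mathbf r$. Given $\mathcal X^t$, let $U_k\in\mathbb R^{p_k\times r_k}$ consist of $r_k$ leading left singular vectors of $\mathcal M_k(\mathcal X^t)$, let $\mathcal S=\mathcal X^t\times_{k=1}^{d+m}U_k^\top$, let $V_k$ be the Q factor (with $r_k$ orthonormal columns) of a QR decomposition of $\mathcal M_k(\mathcal S)^\top$, let $W_k=\big(\bigotimes_{j\ne k}U_j\big)V_k$, and let $$P_{T}(\mathcal Z)=\mathcal Z\times_{k=1}^{d+m}P_{U_k}+\sum_{k=1}^{d+m}\mathcal T_k\big((I-P_{U_k})\mathcal M_k(\mathcal Z)P_{W_k}\big).$$ With $\mathcal G^t=P_T\mathscr A^*(\mathscr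 A(\mathcal X^t)-\mathcal Y)$ and $\alpha_t=\|\mathcal G^t\|_F^2/\|\mathscr A(\mathcal G^t)\|_F^2$ (any value if $\mathcal G^t=0$), set $\mathcal X^{t+1}=\mathcal H_{\mathbf r}(\mathcal X^t-\alpha_t\mathcal G^t)$. Here $\mathcal H_{\mathbf r}(\mathcal Z)=\mathcal Z\times_{k=1}^{d+m}P_{\widehat U_k}$ is either the truncated HOSVD, where $\widehat U_k$ consists of $r_k$ leading left singular vectors of $\mathcal M_k(\mathcal Z)$, or the sequentially truncated HOSVD, where $\widehat U_k$ consists of $r_k$ leading left singular vectors of $\mathcal M_k(\mathcal Z\times_{l<k}P_{\widehat U_l})$. Singular vectors and QR factors that are not unique may be chosen arbitrarily. Assume that $\mathscr A$ satisfies the $2\mathbf r$-tensor restricted isometry property, i.e. $0\le R_{2\mathbf r}<1$, and that $$\|\mathcal X^0-\mathcal X^*\|_F\le\frac{R_{2\mathbf r}}{(d+m)(1+R_{2\mathbf r+\mathbf r^*}-R_{2\mathbf r})}\,\underline\lambda,\qquad R_{2\mathbf r}\le\frac{1}{8(\sqrt{d+m}+1)+1},$$ $$R_{2\mathbf r}(1-R_{2\mathbf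 r})\,\underline\lambda\ \ge\ 2(1+R_{2\mathbf r+\mathbf r^*}-R_{2\mathbf r})(\sqrt{d+m}+1)(d+m)\,\|(\mathscr A^*(\mathcal E))_{\max(2\mathbf r)}\|_F .$$ Then for all $t\ge 0$, $$\|\mathcal X^t-\mathcal X^*\|_F\le 2^{-t}\|\mathcal X^0-\mathcal X^*\|_F+\frac{2(\sqrt{d+m}+1)}{1-R_{2\mathbf r}}\,\|(\mathscr A^*(\mathcal E))_{\max(2\mathbf r)}\|_F .$$ In particular, if $\mathcal E=0$, then $\|\mathcal X^t-\mathcal X^*\|_F\le 2^{-t}\|\mathcal X^0-\mathcal X^*\|_F$ for all $t\ge0$. -/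

import Mathlib

noncomputable section

/-- Real tensors of order `s` with mode sizes `p 0, …, p (s - 1)`.  The norm of this Euclidean space
is the Frobenius norm and its inner product is the entrywise one. -/
abbrev Tensor {s : ℕ} (p : Fin s → ℕ) : Type :=
  EuclideanSpace ℝ (∀ k : Fin s, Fin (p k))

/-- Multi-indices for all modes except mode `k`; they index the columns of the mode-`k` unfolding. -/
abbrev OtherModes {s : ℕ} (p : Fin s → ℕ) (k : Fin s) : Type :=
  ∀ j : {j : Fin s // j ≠ k}, Fin (p j)


section Tensors

variable {s : ℕ} {p q : Fin s → ℕ}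

/-- The mode-`k` matricization `M_k(X)`, with columns indexed by the remaining multi-indices. -/
def matricize (k : Fin s) (X : Tensor p) : Matrix (Fin (p k)) (OtherModes p k) ℝ :=
  Matrix.of fun i c => X ((Equiv.piSplitAt k fun j => Fin (p j)).symm (i, c))

/-- The mode-`k` tensorization `T_k`, the inverse of `matricize k`. -/
def tensorize (k : Fin s) (M : Matrix (Fin (p k)) (OtherModes p k) ℝ) : Tensor p :=
  WithLp.toLp 2 fun i => M (i k) fun j => i j

theorem tensorize_matricize (k : Fin s) (X : Tensor p) : tensorize k (matricize k X) = X := by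
  ext i
  exact congrArg X.ofLp ((Equiv.piSplitAt k fun j => Fin (p j)).symm_apply_apply i)

theorem matricize_tensorize (k : Fin s) (M : Matrix (Fin (p k)) (OtherModes p k) ℝ) :
    matricize k (tensorize k M) = M := by
  ext i c
  have h := (Equiv.piSplitAt k fun j => Fin (p j)).apply_symm_apply (i, c)
  exact congrArg (fun x => M x.1 x.2) h

/-- The Tucker rank `(rank M_1(X), …, rank M_s(X))`. -/
def tuckerRank (X : Tensor p) : Fin s → ℕ := fun k => (matricize k X).rank

/-- The product `X ×_1 B_1 ×_2 ⋯ ×_s B_s` along all modes. -/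
def modeProd (X : Tensor p) (B : ∀ k, Matrix (Fin (q k)) (Fin (p k)) ℝ) : Tensor q :=
  WithLp.toLp 2 fun j => ∑ i : ∀ k, Fin (p k), X i * ∏ k, B k (j k) (i k)

end Tensors



/-- The `j`-th largest singular value `σ_j(M)`, counted from `j = 1`. -/
def sigma {a b : Type*} [Fintype a] [Fintype b] [DecidableEq a] [DecidableEq b]
    (M : Matrix a b ℝ) (j : ℕ) : ℝ :=
  (Matrix.toEuclideanLin M).singularValues (j - 1)

/-- The smallest, over the modes `k`, of the singular values `σ_{ρ_k}(M_k(X))`. -/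
def minSigma {s : ℕ} {p : Fin s → ℕ} (ρ : Fin s → ℕ) (X : Tensor p) : ℝ :=
  ⨅ k, sigma (matricize k X) (ρ k)

/-- `U = SVD_r(M)`: the columns of `U` are the `r` leading left singular vectors of `M`, i.e. the
first `r` vectors of an orthonormal basis of eigenvectors of `M Mᵀ` that is sorted by decreasing
eigenvalue.  Singular vectors are not unique, so this is a relation. -/
def IsSVD {a r : ℕ} {b : Type*} [Fintype b] (M : Matrix (Fin a) b ℝ)
    (U : Matrix (Fin a) (Fin r) ℝ) : Prop :=
  ∃ (P : Matrix (Fin a) (Fin a) ℝ) (e : Fin a → ℝ) (h : r ≤ a),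
    P.transpose * P = 1 ∧ Antitone e ∧
    M * M.transpose = P * Matrix.diagonal e * P.transpose ∧
    U = P.submatrix id (Fin.castLE h)

/-- `V` is a Q factor of a QR decomposition of `M`. -/
def IsQR {a : Type*} [Fintype a] {r : ℕ} (M V : Matrix a (Fin r) ℝ) : Prop :=
  V.transpose * V = 1 ∧
    ∃ R : Matrix (Fin r) (Fin r) ℝ, R.BlockTriangular id ∧ M = V * R

section Geometry

variable {s : ℕ} {p : Fin s → ℕ} {r : Fin s → ℕ}

/-- The projector `P_U = U Uᵀ`. -/
def proj {a b : Type*} [Fintype b] (U : Matrix a b ℝ) : Matrix a a ℝ := U * U.transpose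

/-- The Kronecker product of the matrices `U_j`, `j ≠ k`, applied to `V`; this is `W_k`. -/
def rowFactor (U : ∀ k, Matrix (Fin (p k)) (Fin (r k)) ℝ) (k : Fin s)
    (V : Matrix (OtherModes r k) (Fin (r k)) ℝ) : Matrix (OtherModes p k) (Fin (r k)) ℝ :=
  (Matrix.of fun (c : OtherModes p k) (c' : OtherModes r k) =>
    ∏ j : {j : Fin s // j ≠ k}, U j (c j) (c' j)) * V

/-- The factors of `X` used for the tangent space: `U_k = SVD_{r_k}(M_k(X))`, and with the core
`S = X ×_1 U_1ᵀ ⋯ ×_s U_sᵀ`, `V_k = QR(M_k(S)ᵀ)`. -/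
def IsTuckerFrame (X : Tensor p) (U : ∀ k, Matrix (Fin (p k)) (Fin (r k)) ℝ)
    (V : ∀ k, Matrix (OtherModes r k) (Fin (r k)) ℝ) : Prop :=
  (∀ k, IsSVD (matricize k X) (U k)) ∧
    ∀ k, IsQR (matricize k (modeProd X fun j => (U j).transpose)).transpose (V k)

/-- The tangent space projector
`Z ↦ Z ×_1 P_{U_1} ⋯ ×_s P_{U_s} + ∑_k T_k ((I - P_{U_k}) M_k(Z) P_{W_k})`. -/
def tangentProj (U : ∀ k, Matrix (Fin (p k)) (Fin (r k)) ℝ)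
    (V : ∀ k, Matrix (OtherModes r k) (Fin (r k)) ℝ) (Z : Tensor p) : Tensor p :=
  modeProd Z (fun k => proj (U k)) +
    ∑ k, tensorize k ((1 - proj (U k)) * matricize k Z * proj (rowFactor U k (V k)))

/-- `Y'` is an output of the truncated HOSVD of `Y` with rank `r`. -/
def IsTHOSVD (r : Fin s → ℕ) (Y Y' : Tensor p) : Prop :=
  ∃ U : ∀ k, Matrix (Fin (p k)) (Fin (r k)) ℝ,
    (∀ k, IsSVD (matricize k Y) (U k)) ∧ Y' = modeProd Y fun k => proj (U k)

/-- `Y'` is an output of the sequentially truncated HOSVD of `Y` with rank `r`: the `k`-th factor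
comes from `Y ×_1 P_{U_1} ⋯ ×_{k-1} P_{U_{k-1}}`. -/
def IsSTHOSVD (r : Fin s → ℕ) (Y Y' : Tensor p) : Prop :=
  ∃ U : ∀ k, Matrix (Fin (p k)) (Fin (r k)) ℝ,
    (∀ k, IsSVD (matricize k (modeProd Y fun l => if l < k then proj (U l) else 1)) (U k)) ∧
      Y' = modeProd Y fun k => proj (U k)

/-- `B` is a best approximation of `Z`, in Frobenius norm, among the tensors of Tucker rank at
most `r`. -/
def IsBestApprox (r : Fin s → ℕ) (Z B : Tensor p) : Prop :=
  tuckerRank B ≤ r ∧ ∀ B' : Tensor p, tuckerRank B' ≤ r → ‖Z - B‖ ≤ ‖Z - B'‖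

theorem isClosed_tuckerRank_le (r : Fin s → ℕ) : IsClosed {B : Tensor p | tuckerRank B ≤ r} := by
  have h1 : {B : Tensor p | tuckerRank B ≤ r} = ⋂ k, {B : Tensor p | (matricize k B).rank ≤ r k} := by
    ext B
    simp [tuckerRank, Pi.le_def]
  rw [h1]
  refine isClosed_iInter fun k => ?_
  let L : Tensor p →ₗ[ℝ] ((OtherModes p k → ℝ) →L[ℝ] (Fin (p k) → ℝ)) :=
    { toFun := fun B => LinearMap.toContinuousLinearMap (matricize k B).mulVecLin
      map_add' := fun B C => by
        ext v i
        simp [matricize, Matrix.mulVec, dotProduct, add_mul, Finset.sum_add_distrib]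
      map_smul' := fun c B => by
        ext v i
        simp [matricize, Matrix.mulVec, dotProduct, mul_assoc, Finset.mul_sum] }
  have hL : Continuous L := L.continuous_of_finiteDimensional
  have ho := (isOpen_setOfPred_nat_le_rank (𝕜 := ℝ)
    (E := OtherModes p k → ℝ) (F := Fin (p k) → ℝ) (r k + 1)).preimage hL
  rw [← isOpen_compl_iff]
  convert ho using 1
  ext B
  have h2 : (((L B : (OtherModes p k → ℝ) →L[ℝ] (Fin (p k) → ℝ)) :
      (OtherModes p k → ℝ) →ₗ[ℝ] (Fin (p k) → ℝ))).rank = ((matricize k B).rank : Cardinal) := by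
    rw [Matrix.rank, LinearMap.rank, Module.finrank_eq_rank]
    rfl
  simp only [Set.mem_compl_iff, Set.mem_ofPred_eq, not_le, Set.mem_preimage]
  rw [h2]
  exact_mod_cast Nat.lt_iff_add_one_le

theorem exists_isBestApprox (r : Fin s → ℕ) (Z : Tensor p) : ∃ B, IsBestApprox r Z B := by
  have hne : {B : Tensor p | tuckerRank B ≤ r}.Nonempty := by
    refine ⟨0, fun k => ?_⟩
    have h0 : matricize k (0 : Tensor p) = 0 := by
      ext i c
      simp [matricize]
    simp [tuckerRank, h0]
  obtain ⟨B, hB, h⟩ := (isClosed_tuckerRank_le (p := p) r).exists_infDist_eq_dist hne Z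
  refine ⟨B, hB, fun B' hB' => ?_⟩
  rw [← dist_eq_norm, ← dist_eq_norm, ← h]
  exact Metric.infDist_le_dist_of_mem hB'

/-- `Z_{max(r)}`: a best approximation of `Z` of Tucker rank at most `r`.  Any two choices have the
same Frobenius norm. -/
def maxApprox (r : Fin s → ℕ) (Z : Tensor p) : Tensor p := (exists_isBestApprox r Z).choose

end Geometry

section Regression

variable {d m n : ℕ} {p : Fin (d + m) → ℕ}

/-- The covariate space `ℝ^{p_1 × ⋯ × p_d}`. -/
abbrev Covariate (p : Fin (d + m) → ℕ) : Type := Tensor fun k : Fin d => p (Fin.castAdd m k)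

/-- The space `ℝ^{n × p_{d+1} × ⋯ × p_{d+m}}` of stacked responses, with the Frobenius norm. -/
abbrev Response (n : ℕ) (p : Fin (d + m) → ℕ) : Type :=
  EuclideanSpace ℝ (Fin n × ∀ l : Fin m, Fin (p (Fin.natAdd d l)))

/-- The linear map of tensor-on-tensor regression, `𝒜(X)_i = ⟨A_i, X⟩_*`, where `⟨·,·⟩_*`
contracts the first `d` modes. -/
def regMap (A : Fin n → Covariate p) : Tensor p →ₗ[ℝ] Response n p where
  toFun X := WithLp.toLp 2 fun ij => ∑ κ : ∀ k : Fin d, Fin (p (Fin.castAdd m k)),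
    A ij.1 κ * X (Fin.addCases (motive := fun k => Fin (p k)) κ ij.2)
  map_add' X Y := by
    ext ij
    simp [mul_add, Finset.sum_add_distrib]
  map_smul' c X := by
    ext ij
    simp [Finset.mul_sum, mul_left_comm]

/-- The tensor restricted isometry constant `R_r`: the smallest `R` for which
`(1 - R) ‖Z‖² ≤ ‖𝒜(Z)‖² ≤ (1 + R) ‖Z‖²` for all `Z` of Tucker rank at most `r`. -/
def tripConst (L : Tensor p →ₗ[ℝ] Response n p) (r : Fin (d + m) → ℕ) : ℝ :=
  sInf {R : ℝ | ∀ Z : Tensor p, tuckerRank Z ≤ r →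
    (1 - R) * ‖Z‖ ^ 2 ≤ ‖L Z‖ ^ 2 ∧ ‖L Z‖ ^ 2 ≤ (1 + R) * ‖Z‖ ^ 2}

/-- The tensor restricted isometry property. -/
def SatisfiesTRIP (L : Tensor p →ₗ[ℝ] Response n p) (r : Fin (d + m) → ℕ) : Prop :=
  0 ≤ tripConst L r ∧ tripConst L r < 1

/-- One iteration `X ↦ X'` of Riemannian gradient descent with input rank `r`: a step along the
Riemannian gradient `G = P_{T_X} 𝒜*(𝒜(X) - Y)` with the exact line search step size
`‖G‖² / ‖𝒜(G)‖²` (immaterial if `G = 0`), followed by T-HOSVD or ST-HOSVD. -/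
def IsRGDStep (L : Tensor p →ₗ[ℝ] Response n p) (Y : Response n p) (r : Fin (d + m) → ℕ)
    (X X' : Tensor p) : Prop :=
  ∃ (U : ∀ k, Matrix (Fin (p k)) (Fin (r k)) ℝ)
    (V : ∀ k, Matrix (OtherModes r k) (Fin (r k)) ℝ) (G Xhalf : Tensor p),
    IsTuckerFrame X U V ∧
    G = tangentProj U V (LinearMap.adjoint L (L X - Y)) ∧
    Xhalf = X - (‖G‖ ^ 2 / ‖L G‖ ^ 2) • G ∧
    (IsTHOSVD r Xhalf X' ∨ IsSTHOSVD r Xhalf X')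

/-- `X 0, X 1, …` is a run of Riemannian gradient descent with input rank `r`, initialized at a
tensor of Tucker rank `r`. -/
def IsRGDRun (L : Tensor p →ₗ[ℝ] Response n p) (Y : Response n p) (r : Fin (d + m) → ℕ)
    (X : ℕ → Tensor p) : Prop :=
  tuckerRank (X 0) = r ∧ ∀ t, IsRGDStep L Y r (X t) (X (t + 1))

end Regression

end

/-! Write `s = d + m` and `q = √s + 1`, and let `R`, `R'` be the restricted isometry constants for
`2r` and `2r + r*`. Let `e = ‖X - X*‖` for the current iterate, let `T` be the tangent projector at
`X`, and let `D = X* - T X*`. The proof is a one-step recursion for `e` with a linear, a quadratic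
and a noise term.

Gradient step. `T` is an orthogonal projection, `T X = X`, and its range has Tucker rank at most
`2r`. With `z = T (X - X*)`, the error before truncation is `w - D + α v + α T 𝒜*E`, where `w = z -
α T 𝒜*𝒜 z` and `v = T 𝒜*𝒜 D`. Isometry on the range of `T` gives `‖w‖ ≤ 2R/(1-R) e`; isometry on
that range enlarged by `D`, together with `v ⟂ D`, gives `‖v‖ ≤ R' ‖D‖`
(`norm_projected_gradient_step_le`). The noise is bounded by the best rank-`2r` approximation of
`𝒜*E` (`norm_projection_le_maxApprox`).

Curvature. `λ ‖D‖ ≤ s e²` (`IsTuckerFrame.norm_normal_le`). `D` splits into one piece `A M B` per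
mode, where `M` is the unfolding of `X*` and `A`, `B` annihilate the unfolding of `X` from the left
and the right. So `‖A M‖` and `‖M B‖` are both at most `e`, and `σ ‖A M B‖ ≤ ‖A M‖ ‖M B‖` for the
smallest nonzero singular value `σ` of `M` (`sigma_sq_mul_frobSq_le`).

Truncation. Both versions of HOSVD are optimal up to the factor `√s`, so truncating multiplies the
error bound by at most `q`.

Together, the next error is at most `q/(1-R) (2R + C e) e + N` with `C = s (1 + R' - R)/λ` and `N =
q/(1-R) ‖(𝒜*E)_max‖`. The initialization and signal conditions keep `C e ≤ 2R` along the run, the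
bound on `R` turns the first summand into at most `e/2`, and the noise terms form a geometric series
with sum at most `2N`. -/

noncomputable section

/-! ### Frobenius norms, orthogonal projections, best low-rank approximation and singular values. -/

section MatrixLemmas

open Matrix

variable {a b c : Type*} [Fintype a] [Fintype b] [Fintype c]

/-- The squared Frobenius norm of a matrix. -/
def frobSq (M : Matrix a b ℝ) : ℝ := ∑ i, ∑ j, M i j ^ 2

theorem frobSq_nonneg (M : Matrix a b ℝ) : 0 ≤ frobSq M :=
  Finset.sum_nonneg fun _ _ => Finset.sum_nonneg fun _ _ => sq_nonneg _

theorem frobSq_transpose (M : Matrix a b ℝ) : frobSq Mᵀ = frobSq M := by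
  simpa [frobSq] using Finset.sum_comm

theorem frobSq_eq_trace (M : Matrix a b ℝ) : frobSq M = (M * Mᵀ).trace := by
  simp [frobSq, Matrix.trace, Matrix.mul_apply, sq]

theorem frobSq_neg (M : Matrix a b ℝ) : frobSq (-M) = frobSq M := by
  simp [frobSq]

theorem frobSq_eq_zero {M : Matrix a b ℝ} (h : frobSq M ≤ 0) : M = 0 := by
  ext i j
  have h1 : M i j ^ 2 ≤ ∑ j, M i j ^ 2 :=
    Finset.single_le_sum (f := fun j => M i j ^ 2) (fun _ _ => sq_nonneg _) (Finset.mem_univ j)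
  have h2 : ∑ j, M i j ^ 2 ≤ frobSq M :=
    Finset.single_le_sum (f := fun i => ∑ j, M i j ^ 2)
      (fun _ _ => Finset.sum_nonneg fun _ _ => sq_nonneg _) (Finset.mem_univ i)
  exact pow_eq_zero_iff two_ne_zero |>.mp (le_antisymm (h1.trans (h2.trans h)) (sq_nonneg _))

/-- Orthogonal projection matrices. -/
structure IsOrthProj (P : Matrix a a ℝ) : Prop where
  symm : Pᵀ = P
  idem : P * P = P

namespace IsOrthProj

theorem one [DecidableEq a] : IsOrthProj (1 : Matrix a a ℝ) := ⟨by simp, by simp⟩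

theorem one_sub [DecidableEq a] {P : Matrix a a ℝ} (h : IsOrthProj P) : IsOrthProj (1 - P) :=
  ⟨by simp [h.symm], by simp [mul_sub, sub_mul, h.idem]⟩

theorem proj {r : Type*} [Fintype r] [DecidableEq r] {U : Matrix a r ℝ} (h : Uᵀ * U = 1) :
    IsOrthProj (proj U) := by
  refine ⟨by simp [_root_.proj], ?_⟩
  rw [_root_.proj, Matrix.mul_assoc, ← Matrix.mul_assoc Uᵀ, h, Matrix.one_mul]

theorem sub {P Q : Matrix a a ℝ} (hP : IsOrthProj P) (hQ : IsOrthProj Q) (h : P * Q = Q) :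
    IsOrthProj (P - Q) := by
  have h' : Q * P = Q := by
    have := congrArg Matrix.transpose h
    rwa [Matrix.transpose_mul, hP.symm, hQ.symm] at this
  exact ⟨by simp [hP.symm, hQ.symm], by simp [mul_sub, sub_mul, hP.idem, hQ.idem, h, h']⟩

theorem frobSq_mul_eq_trace {P : Matrix a a ℝ} (h : IsOrthProj P) (M : Matrix a b ℝ) :
    frobSq (P * M) = (P * (M * Mᵀ)).trace := by
  rw [frobSq_eq_trace, Matrix.transpose_mul, h.symm, Matrix.trace_mul_comm, Matrix.mul_assoc,
    ← Matrix.mul_assoc P P, h.idem, Matrix.trace_mul_comm, Matrix.mul_assoc]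

theorem frobSq_add [DecidableEq a] {P : Matrix a a ℝ} (h : IsOrthProj P) (M : Matrix a b ℝ) :
    frobSq (P * M) + frobSq ((1 - P) * M) = frobSq M := by
  rw [h.frobSq_mul_eq_trace, h.one_sub.frobSq_mul_eq_trace, ← Matrix.trace_add, ← add_mul,
    add_sub_cancel, Matrix.one_mul, frobSq_eq_trace]

theorem frobSq_mul_le {P : Matrix a a ℝ} (h : IsOrthProj P) (M : Matrix a b ℝ) :
    frobSq (P * M) ≤ frobSq M := by
  classical
  rw [← h.frobSq_add M]
  linarith [frobSq_nonneg ((1 - P) * M)]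

theorem frobSq_mul_le_right {P : Matrix b b ℝ} (h : IsOrthProj P) (M : Matrix a b ℝ) :
    frobSq (M * P) ≤ frobSq M := by
  rw [← frobSq_transpose, ← frobSq_transpose M, Matrix.transpose_mul, h.symm]
  exact h.frobSq_mul_le _

theorem apply_le_one {P : Matrix a a ℝ} (h : IsOrthProj P) (i : a) : P i i ≤ 1 := by
  have h1 : P i i = ∑ j, P i j ^ 2 := by
    conv_lhs => rw [← h.idem, Matrix.mul_apply]
    refine Finset.sum_congr rfl fun j _ => ?_
    rw [sq, ← congrFun (congrFun h.symm i) j, Matrix.transpose_apply]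
  have h2 : P i i ^ 2 ≤ P i i := by
    conv_rhs => rw [h1]
    exact Finset.single_le_sum (f := fun j => P i j ^ 2) (fun _ _ => sq_nonneg _)
      (Finset.mem_univ i)
  nlinarith

theorem apply_nonneg {P : Matrix a a ℝ} (h : IsOrthProj P) (i : a) : 0 ≤ P i i := by
  rw [← h.idem, Matrix.mul_apply]
  refine Finset.sum_nonneg fun j _ => ?_
  rw [← congrFun (congrFun h.symm i) j, Matrix.transpose_apply]
  exact mul_self_nonneg _

end IsOrthProj

/-- The orthogonal projection onto the column space of a matrix. -/
theorem exists_isOrthProj_mul_eq (N : Matrix a b ℝ) :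
    ∃ P : Matrix a a ℝ, IsOrthProj P ∧ P * N = N ∧ P.trace = N.rank := by
  classical
  let K : Submodule ℝ (EuclideanSpace ℝ a) := LinearMap.range (Matrix.toEuclideanLin N)
  let β := stdOrthonormalBasis ℝ K
  let Q : Matrix a (Fin (Module.finrank ℝ K)) ℝ := Matrix.of fun i j => (β j : EuclideanSpace ℝ a) i
  have hQ : Qᵀ * Q = 1 := by
    ext i j
    have h := orthonormal_iff_ite.mp β.orthonormal i j
    rw [Submodule.coe_inner, PiLp.inner_apply] at h
    simp only [RCLike.inner_apply, conj_trivial] at h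
    rw [Matrix.one_apply, ← h, Matrix.mul_apply]
    exact Finset.sum_congr rfl fun l _ => mul_comm _ _
  refine ⟨proj Q, IsOrthProj.proj hQ, ?_, ?_⟩
  · ext i j
    let y : K := ⟨Matrix.toEuclideanLin N (EuclideanSpace.single j 1), LinearMap.mem_range_self _ _⟩
    have hy : ∀ i, (y : EuclideanSpace ℝ a) i = N i j := by
      intro i
      simp [y, Matrix.toLpLin_apply]
    have h := congrArg (fun z : K => (z : EuclideanSpace ℝ a) i) (β.sum_repr' y)
    simp only [Submodule.coe_sum, Submodule.coe_smul, WithLp.ofLp_sum, WithLp.ofLp_smul,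
      Finset.sum_apply, Pi.smul_apply, Submodule.coe_inner, smul_eq_mul, PiLp.inner_apply,
      RCLike.inner_apply, conj_trivial, hy] at h
    rw [proj, Matrix.mul_assoc, Matrix.mul_apply, ← h]
    refine Finset.sum_congr rfl fun l _ => ?_
    rw [Matrix.mul_apply, mul_comm]
    exact congrArg (· * _) (Finset.sum_congr rfl fun x _ => mul_comm _ _)
  · rw [proj, Matrix.trace_mul_comm, hQ, Matrix.trace_one, Fintype.card_fin,
      Matrix.rank_eq_finrank_range_toLin N (EuclideanSpace.basisFun a ℝ).toBasis
        (EuclideanSpace.basisFun b ℝ).toBasis]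
    rfl

/-- Fractional knapsack: weights in `[0, 1]` of total at most `r` do best on the `r` largest values.
This is the Ky Fan step in the best approximation property of the SVD. -/
theorem sum_mul_le_sum_ite {n r : ℕ} (hr : r ≤ n) {e w : Fin n → ℝ} (he : Antitone e)
    (he0 : ∀ i, 0 ≤ e i) (hw0 : ∀ i, 0 ≤ w i) (hw1 : ∀ i, w i ≤ 1) (hw : ∑ i, w i ≤ r) :
    ∑ i, e i * w i ≤ ∑ i : Fin n, if (i : ℕ) < r then e i else 0 := by
  -- A threshold separating the first `r` values from the rest acts as a Lagrange multiplier: adding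
  -- `t * (1_{i < r} - w i)` makes the inequality hold term by term.
  obtain ⟨t, ht0, ht1, ht2⟩ : ∃ t : ℝ, 0 ≤ t ∧ (∀ i : Fin n, (i : ℕ) < r → t ≤ e i) ∧
      ∀ i : Fin n, r ≤ (i : ℕ) → e i ≤ t := by
    rcases hr.lt_or_eq with h | rfl
    · exact ⟨e ⟨r, h⟩, he0 _, fun i hi => he hi.le, fun i hi => he hi⟩
    · exact ⟨0, le_rfl, fun i _ => he0 i, fun i hi => absurd i.2 (not_lt.mpr hi)⟩
  have hcard : ∑ i : Fin n, (if (i : ℕ) < r then (1 : ℝ) else 0) = r := by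
    rw [Fin.sum_univ_eq_sum_range (fun i => if i < r then (1 : ℝ) else 0) n,
      ← Finset.sum_filter, Finset.sum_const, nsmul_one]
    congr 1
    have : (Finset.range n).filter (· < r) = Finset.range r := by
      ext i
      simp only [Finset.mem_filter, Finset.mem_range]
      omega
    rw [this, Finset.card_range]
  have key : ∑ i, e i * w i + t * ∑ i : Fin n, ((if (i : ℕ) < r then (1 : ℝ) else 0) - w i) ≤
      ∑ i : Fin n, if (i : ℕ) < r then e i else 0 := by
    rw [Finset.mul_sum, ← Finset.sum_add_distrib]
    refine Finset.sum_le_sum fun i _ => ?_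
    split_ifs with h
    · nlinarith [ht1 i h, hw1 i]
    · nlinarith [ht2 i (not_lt.mp h), hw0 i]
  rw [Finset.sum_sub_distrib, hcard] at key
  nlinarith

theorem IsSVD.transpose_mul_self {n r : ℕ} {M : Matrix (Fin n) b ℝ} {U : Matrix (Fin n) (Fin r) ℝ}
    (h : IsSVD M U) : Uᵀ * U = 1 := by
  obtain ⟨P, e, hr, hP, -, -, rfl⟩ := h
  ext i j
  have := congrFun (congrFun hP (Fin.castLE hr i)) (Fin.castLE hr j)
  simpa [Matrix.mul_apply, Matrix.one_apply] using this

/-- The projection onto the leading singular vectors gives a best low-rank approximation. -/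
theorem IsSVD.frobSq_le {n r : ℕ} {M : Matrix (Fin n) b ℝ} {U : Matrix (Fin n) (Fin r) ℝ}
    (h : IsSVD M U) (N : Matrix (Fin n) b ℝ) (hN : N.rank ≤ r) :
    frobSq ((1 - proj U) * M) ≤ frobSq (M - N) := by
  obtain ⟨Q, hQ, hQN, hQt⟩ := exists_isOrthProj_mul_eq N
  have hU := IsOrthProj.proj h.transpose_mul_self
  obtain ⟨P, e, hr, hP, he, hM, rfl⟩ := h
  have hP' : P * Pᵀ = 1 := mul_eq_one_comm.mp hP
  -- Since `1 - Q` kills `N`, it suffices to compare `Q` with the spectral projector: among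
  -- projections of rank at most `r`, the latter captures the most of `M`.
  have h1 : frobSq ((1 - Q) * M) ≤ frobSq (M - N) := by
    refine le_trans (le_of_eq ?_) (hQ.one_sub.frobSq_mul_le (M - N))
    rw [Matrix.mul_sub, Matrix.sub_mul 1 Q N, hQN]
    simp
  have he0 : ∀ i, 0 ≤ e i := by
    intro i
    have h2 : Pᵀ * M * (Pᵀ * M)ᵀ = Matrix.diagonal e := by
      rw [Matrix.transpose_mul, Matrix.transpose_transpose, Matrix.mul_assoc, ← Matrix.mul_assoc M,
        hM, ← Matrix.mul_assoc, ← Matrix.mul_assoc, ← Matrix.mul_assoc, hP, Matrix.one_mul,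
        Matrix.mul_assoc, hP, Matrix.mul_one]
    have h3 := congrFun (congrFun h2 i) i
    rw [Matrix.diagonal_apply_eq] at h3
    rw [← h3, Matrix.mul_apply]
    exact Finset.sum_nonneg fun j _ => mul_self_nonneg _
  have htr : ∀ S : Matrix (Fin n) (Fin n) ℝ, (S * (M * Mᵀ)).trace = ∑ i, e i * (Pᵀ * S * P) i i := by
    intro S
    rw [hM, Matrix.trace_mul_comm, Matrix.mul_assoc, Matrix.mul_assoc, Matrix.trace_mul_comm,
      Matrix.mul_assoc]
    simp [Matrix.trace, Matrix.diagonal_mul]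
  have hW : IsOrthProj (Pᵀ * Q * P) := by
    refine ⟨by simp [hQ.symm, Matrix.mul_assoc], ?_⟩
    calc Pᵀ * Q * P * (Pᵀ * Q * P) = Pᵀ * (Q * (P * Pᵀ) * Q) * P := by simp only [Matrix.mul_assoc]
      _ = _ := by rw [hP', Matrix.mul_one, hQ.idem]
  -- In the eigenbasis both sides are weighted sums of eigenvalues. The weights of `Q` are the
  -- diagonal entries of a projection, hence lie in `[0, 1]`, and their sum is its trace `N.rank ≤
  -- r`.
  have h4 : frobSq (Q * M) ≤ frobSq (proj (P.submatrix id (Fin.castLE hr)) * M) := by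
    rw [hQ.frobSq_mul_eq_trace, hU.frobSq_mul_eq_trace, htr, htr]
    refine (sum_mul_le_sum_ite hr he he0 hW.apply_nonneg hW.apply_le_one ?_).trans (le_of_eq ?_)
    · have : (Pᵀ * Q * P).trace = N.rank := by
        rw [Matrix.trace_mul_comm, ← Matrix.mul_assoc, hP', Matrix.one_mul, hQt]
      calc ∑ i, (Pᵀ * Q * P) i i = N.rank := this
        _ ≤ r := by exact_mod_cast hN
    · refine Finset.sum_congr rfl fun i _ => ?_
      have h5 : Pᵀ * proj (P.submatrix id (Fin.castLE hr)) * P =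
          (1 : Matrix (Fin n) (Fin n) ℝ).submatrix id (Fin.castLE hr) *
            ((1 : Matrix (Fin n) (Fin n) ℝ).submatrix id (Fin.castLE hr))ᵀ := by
        have h6 : Pᵀ * P.submatrix id (Fin.castLE hr) =
            (1 : Matrix (Fin n) (Fin n) ℝ).submatrix id (Fin.castLE hr) := by
          rw [← hP]
          rfl
        rw [← h6, proj, Matrix.transpose_mul, Matrix.transpose_transpose]
        simp only [Matrix.mul_assoc]
      rw [h5, Matrix.mul_apply]
      split_ifs with hi
      · rw [Finset.sum_eq_single (⟨i, hi⟩ : Fin r)]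
        · simp [Matrix.one_apply]
        · intro j _ hj
          have : i ≠ Fin.castLE hr j := by
            rintro rfl
            exact hj rfl
          simp [this]
        · simp
      · rw [Finset.sum_eq_zero, mul_zero]
        intro j _
        have : i ≠ Fin.castLE hr j := by
          rintro rfl
          exact hi j.2
        simp [this]
  linarith [hQ.frobSq_add M, hU.frobSq_add M]

/-- `M` itself competes in the best approximation property, so the residual is zero. -/
theorem IsSVD.proj_mul_self {n r : ℕ} {M : Matrix (Fin n) b ℝ} {U : Matrix (Fin n) (Fin r) ℝ}
    (h : IsSVD M U) (hM : M.rank ≤ r) : proj U * M = M := by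
  have h1 := h.frobSq_le M hM
  rw [sub_self, show frobSq (0 : Matrix (Fin n) b ℝ) = 0 by simp [frobSq]] at h1
  have h2 := frobSq_eq_zero h1
  rw [Matrix.sub_mul, Matrix.one_mul, sub_eq_zero] at h2
  exact h2.symm

/-- The smallest nonzero singular value bounds `T` from below on the row space. -/
theorem singularValues_sq_mul_inner_sq_le {E F : Type*} [NormedAddCommGroup E]
    [InnerProductSpace ℝ E] [FiniteDimensional ℝ E] [NormedAddCommGroup F] [InnerProductSpace ℝ F]
    [FiniteDimensional ℝ F] (T : E →ₗ[ℝ] F) (u : F) (v : E) :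
    T.singularValues (Module.finrank ℝ T.range - 1) ^ 2 * inner ℝ u (T v) ^ 2 ≤
      ‖LinearMap.adjoint T u‖ ^ 2 * ‖T v‖ ^ 2 := by
  -- Singular values are indexed from `0`, so for positive rank this is the smallest nonzero one.
  set σ := T.singularValues (Module.finrank ℝ T.range - 1)
  have hsymm := T.isSymmetric_adjoint_comp_self
  let β := hsymm.eigenvectorBasis rfl
  let μ := hsymm.eigenvalues rfl
  have hμ0 : ∀ i, 0 ≤ μ i := T.isPositive_adjoint_comp_self.nonneg_eigenvalues rfl
  have hβ : ∀ i, LinearMap.adjoint T (T (β i)) = μ i • β i := fun i =>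
    hsymm.apply_eigenvectorBasis rfl i
  have hker : ∀ i, μ i = 0 → T (β i) = 0 := by
    intro i hi
    have h1 : inner ℝ (T (β i)) (T (β i)) = (0 : ℝ) := by
      rw [← LinearMap.adjoint_inner_right, hβ, hi]
      simp
    exact inner_self_eq_zero.mp h1
  have hle : ∀ i, μ i ≠ 0 → σ ^ 2 ≤ μ i := by
    intro i hi
    have h1 : T.singularValues i ^ 2 = μ i := T.sq_singularValues_fin rfl i
    have h2 : 0 < T.singularValues i := by
      rw [T.singularValues_pos_iff_ne_zero]
      intro h
      rw [h] at h1
      exact hi (by rw [← h1]; simp)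
    rw [T.singularValues_pos_iff_lt_finrank_range] at h2
    rw [← h1]
    exact pow_le_pow_left₀ (T.singularValues_nonneg _) (T.singularValues_antitone (by omega)) 2
  have h1 : inner ℝ u (T v) = ∑ i, inner ℝ (LinearMap.adjoint T u) (β i) * inner ℝ (β i) v := by
    rw [β.sum_inner_mul_inner, LinearMap.adjoint_inner_left]
  have h2 : ‖T v‖ ^ 2 = ∑ i, μ i * inner ℝ (β i) v ^ 2 := by
    rw [← real_inner_self_eq_norm_sq, ← LinearMap.adjoint_inner_right, ← β.sum_inner_mul_inner]
    refine Finset.sum_congr rfl fun i _ => ?_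
    rw [LinearMap.adjoint_inner_right, ← LinearMap.adjoint_inner_left, hβ, inner_smul_left,
      real_inner_comm]
    simp only [conj_trivial]
    ring
  -- Kernel directions contribute nothing to the sum, so they can be set to zero before
  -- Cauchy–Schwarz. Every remaining eigenvalue is at least `σ ^ 2`.
  have h3 : σ ^ 2 * inner ℝ u (T v) ^ 2 = (∑ i, inner ℝ (LinearMap.adjoint T u) (β i) *
      (if μ i = 0 then 0 else σ * inner ℝ (β i) v)) ^ 2 := by
    rw [← mul_pow, h1, Finset.mul_sum]
    congr 1
    refine Finset.sum_congr rfl fun i _ => ?_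
    split_ifs with h
    · rw [LinearMap.adjoint_inner_left, hker i h]
      simp
    · ring
  rw [h3]
  refine (Finset.sum_mul_sq_le_sq_mul_sq _ _ _).trans ?_
  have h4 : ‖LinearMap.adjoint T u‖ ^ 2 = ∑ i, inner ℝ (LinearMap.adjoint T u) (β i) ^ 2 := by
    rw [← real_inner_self_eq_norm_sq, ← β.sum_inner_mul_inner]
    refine Finset.sum_congr rfl fun i _ => ?_
    rw [real_inner_comm (LinearMap.adjoint T u) (β i), sq]
  rw [h4, h2]
  refine mul_le_mul_of_nonneg_left (Finset.sum_le_sum fun i _ => ?_)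
    (Finset.sum_nonneg fun _ _ => sq_nonneg _)
  split_ifs with h
  · simp [h]
  · rw [mul_pow]
    exact mul_le_mul_of_nonneg_right (hle i h) (sq_nonneg _)

variable [DecidableEq b]

theorem rank_eq_finrank_range_toEuclideanLin (M : Matrix a b ℝ) :
    M.rank = Module.finrank ℝ (LinearMap.range (Matrix.toEuclideanLin M)) := by
  rw [Matrix.rank_eq_finrank_range_toLin M (EuclideanSpace.basisFun a ℝ).toBasis
        (EuclideanSpace.basisFun b ℝ).toBasis]
  rfl

variable [DecidableEq a]

theorem sigma_rank_pos (M : Matrix a b ℝ) (h : 1 ≤ M.rank) : 0 < sigma M M.rank := by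
  rw [sigma, LinearMap.singularValues_pos_iff_lt_finrank_range,
    ← rank_eq_finrank_range_toEuclideanLin]
  omega

theorem sigma_sq_mul_sq_le (M : Matrix a b ℝ) (u : a → ℝ) (v : b → ℝ) :
    sigma M M.rank ^ 2 * (u ⬝ᵥ M *ᵥ v) ^ 2 ≤ (∑ j, (u ᵥ* M) j ^ 2) * ∑ i, (M *ᵥ v) i ^ 2 := by
  have h := singularValues_sq_mul_inner_sq_le (Matrix.toEuclideanLin M) (WithLp.toLp 2 u)
    (WithLp.toLp 2 v)
  rw [← rank_eq_finrank_range_toEuclideanLin, ← Matrix.toEuclideanLin_conjTranspose_eq_adjoint,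
    Matrix.conjTranspose_eq_transpose_of_trivial,
    EuclideanSpace.real_norm_sq_eq, EuclideanSpace.real_norm_sq_eq, PiLp.inner_apply] at h
  simpa [sigma, Matrix.toLpLin_apply, dotProduct, Matrix.mulVec_transpose,
    mul_comm] using h

/-- Morally `A M B = (A M) M⁺ (M B)` with `‖M⁺‖ = 1 / σ`. The proof sums the vector inequality over
the rows of `A` and the columns of `B`. If `A M` and `M B` are both small, `A M B` is small to
second order. -/
theorem sigma_sq_mul_frobSq_le {d : Type*} [Fintype d] (A : Matrix c a ℝ) (M : Matrix a b ℝ)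
    (B : Matrix b d ℝ) :
    sigma M M.rank ^ 2 * frobSq (A * M * B) ≤ frobSq (A * M) * frobSq (M * B) := by
  rw [← frobSq_transpose (M * B), frobSq, frobSq, frobSq, Finset.sum_mul_sum, Finset.mul_sum]
  refine Finset.sum_le_sum fun i _ => ?_
  rw [Finset.mul_sum]
  refine Finset.sum_le_sum fun j _ => ?_
  have h := sigma_sq_mul_sq_le M (A i) (fun l => B l j)
  have h1 : (A * M * B) i j = A i ⬝ᵥ M *ᵥ (fun l => B l j) := by
    rw [Matrix.mul_assoc]
    rfl
  rw [h1]
  exact h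

end MatrixLemmas

/-! ### Kronecker products of families of matrices. -/

section KroneckerProducts

open Matrix

variable {ι : Type*} [Fintype ι] {α β γ : ι → Type*}

/-- The Kronecker product of a family of matrices. -/
def kron (B : ∀ i, Matrix (α i) (β i) ℝ) : Matrix (∀ i, α i) (∀ i, β i) ℝ :=
  Matrix.of fun c c' => ∏ i, B i (c i) (c' i)

theorem kron_transpose (B : ∀ i, Matrix (α i) (β i) ℝ) : (kron B)ᵀ = kron fun i => (B i)ᵀ := rfl

theorem kron_mul [DecidableEq ι] [∀ i, Fintype (β i)] (A : ∀ i, Matrix (α i) (β i) ℝ)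
    (B : ∀ i, Matrix (β i) (γ i) ℝ) : kron A * kron B = kron fun i => A i * B i := by
  ext c c'
  simp only [kron, Matrix.mul_apply, Matrix.of_apply, ← Finset.prod_mul_distrib]
  rw [Finset.prod_univ_sum, Fintype.piFinset_univ]

theorem kron_one [DecidableEq ι] [∀ i, DecidableEq (α i)] :
    kron (fun i => (1 : Matrix (α i) (α i) ℝ)) = 1 := by
  ext c c'
  simp only [kron, Matrix.of_apply, Matrix.one_apply]
  by_cases h : c = c'
  · simp [h]
  · obtain ⟨i, hi⟩ := Function.ne_iff.mp h
    rw [if_neg h]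
    exact Finset.prod_eq_zero (Finset.mem_univ i) (if_neg hi)

theorem IsOrthProj.kron [DecidableEq ι] [∀ i, Fintype (α i)] {P : ∀ i, Matrix (α i) (α i) ℝ}
    (h : ∀ i, IsOrthProj (P i)) : IsOrthProj (kron P) :=
  ⟨by rw [kron_transpose]; simp [(h _).symm], by rw [kron_mul]; simp [(h _).idem]⟩

end KroneckerProducts

/-! ### Unfoldings, mode products, and two-sided multiplication of unfoldings as an operator
algebra. -/

section TensorLemmas

open Matrix

variable {s : ℕ} {p q r : Fin s → ℕ}

theorem matricize_add (k : Fin s) (X Y : Tensor p) :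
    matricize k (X + Y) = matricize k X + matricize k Y := rfl

theorem matricize_sub (k : Fin s) (X Y : Tensor p) :
    matricize k (X - Y) = matricize k X - matricize k Y := rfl

theorem inner_eq_trace (k : Fin s) (X Y : Tensor p) :
    inner ℝ X Y = ((matricize k X)ᵀ * matricize k Y).trace := by
  rw [PiLp.inner_apply, ← (Equiv.piSplitAt k fun j => Fin (p j)).symm.sum_comp,
    Fintype.sum_prod_type_right]
  simp only [Matrix.trace, Matrix.diag, Matrix.mul_apply]
  exact Finset.sum_congr rfl fun c _ => Finset.sum_congr rfl fun i _ => mul_comm _ _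

theorem norm_sq_eq_frobSq (k : Fin s) (X : Tensor p) : ‖X‖ ^ 2 = frobSq (matricize k X) := by
  rw [← real_inner_self_eq_norm_sq, inner_eq_trace k, ← frobSq_transpose, frobSq_eq_trace,
    Matrix.transpose_transpose]

theorem matricize_modeProd (k : Fin s) (X : Tensor p)
    (B : ∀ k, Matrix (Fin (q k)) (Fin (p k)) ℝ) :
    matricize k (modeProd X B) =
      B k * matricize k X * (kron fun j : {j : Fin s // j ≠ k} => B j)ᵀ := by
  ext i c
  simp only [matricize, modeProd, Matrix.mul_apply, Matrix.of_apply, Matrix.transpose_apply, kron]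
  rw [← (Equiv.piSplitAt k fun j => Fin (p j)).symm.sum_comp, Fintype.sum_prod_type_right]
  refine Finset.sum_congr rfl fun c' _ => ?_
  rw [Finset.sum_mul]
  refine Finset.sum_congr rfl fun i' _ => ?_
  rw [Fintype.prod_eq_mul_prod_subtype_ne _ k]
  have h1 : ∀ {t : Fin s → ℕ} (x : Fin (t k)) (y : OtherModes t k),
      (Equiv.piSplitAt k fun j => Fin (t j)).symm (x, y) k = x := by
    intro t x y
    exact congrArg Prod.fst ((Equiv.piSplitAt k fun j => Fin (t j)).apply_symm_apply (x, y))
  have h2 : ∀ {t : Fin s → ℕ} (x : Fin (t k)) (y : OtherModes t k) (j : {j : Fin s // j ≠ k}),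
      (Equiv.piSplitAt k fun j => Fin (t j)).symm (x, y) j = y j := by
    intro t x y j
    exact congrFun (congrArg Prod.snd
      ((Equiv.piSplitAt k fun j => Fin (t j)).apply_symm_apply (x, y))) j
  simp only [h1, h2]
  ring

/-- Multiplication of the mode-`k` matricization from both sides. -/
def sideMul (k : Fin s) (A : Matrix (Fin (p k)) (Fin (p k)) ℝ)
    (B : Matrix (OtherModes p k) (OtherModes p k) ℝ) : Module.End ℝ (Tensor p) where
  toFun X := tensorize k (A * matricize k X * B)
  map_add' X Y := by
    rw [matricize_add, Matrix.mul_add, Matrix.add_mul]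
    rfl
  map_smul' c X := by
    have h : matricize k (c • X) = c • matricize k X := rfl
    rw [h, Matrix.mul_smul, Matrix.smul_mul]
    rfl

theorem sideMul_apply (k : Fin s) (A : Matrix (Fin (p k)) (Fin (p k)) ℝ)
    (B : Matrix (OtherModes p k) (OtherModes p k) ℝ) (X : Tensor p) :
    sideMul k A B X = tensorize k (A * matricize k X * B) := rfl

theorem matricize_sideMul (k : Fin s) (A : Matrix (Fin (p k)) (Fin (p k)) ℝ)
    (B : Matrix (OtherModes p k) (OtherModes p k) ℝ) (X : Tensor p) :
    matricize k (sideMul k A B X) = A * matricize k X * B :=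
  matricize_tensorize k _

theorem sideMul_mul (k : Fin s) (A A' : Matrix (Fin (p k)) (Fin (p k)) ℝ)
    (B B' : Matrix (OtherModes p k) (OtherModes p k) ℝ) :
    sideMul k A B * sideMul k A' B' = sideMul k (A * A') (B' * B) := by
  ext1 X
  rw [Module.End.mul_apply, sideMul_apply, matricize_sideMul, sideMul_apply]
  simp only [Matrix.mul_assoc]

theorem sideMul_one (k : Fin s) : sideMul (p := p) k 1 1 = 1 := by
  ext1 X
  rw [sideMul_apply, Matrix.one_mul, Matrix.mul_one, tensorize_matricize, Module.End.one_apply]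

theorem sideMul_zero_left (k : Fin s) (B : Matrix (OtherModes p k) (OtherModes p k) ℝ) :
    sideMul k 0 B = 0 := by
  ext1 X
  rw [sideMul_apply, Matrix.zero_mul, Matrix.zero_mul]
  rfl

theorem sideMul_sub_left (k : Fin s) (A A' : Matrix (Fin (p k)) (Fin (p k)) ℝ)
    (B : Matrix (OtherModes p k) (OtherModes p k) ℝ) :
    sideMul k (A - A') B = sideMul k A B - sideMul k A' B := by
  ext1 X
  rw [sideMul_apply, Matrix.sub_mul, Matrix.sub_mul]
  rfl

theorem sideMul_sub_right (k : Fin s) (A : Matrix (Fin (p k)) (Fin (p k)) ℝ)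
    (B B' : Matrix (OtherModes p k) (OtherModes p k) ℝ) :
    sideMul k A (B - B') = sideMul k A B - sideMul k A B' := by
  ext1 X
  rw [sideMul_apply, Matrix.mul_sub]
  rfl

theorem sideMul_isSymmetric {k : Fin s} {A : Matrix (Fin (p k)) (Fin (p k)) ℝ}
    {B : Matrix (OtherModes p k) (OtherModes p k) ℝ} (hA : Aᵀ = A) (hB : Bᵀ = B) :
    (sideMul k A B).IsSymmetric := by
  intro X Y
  rw [inner_eq_trace k, inner_eq_trace k, matricize_sideMul, matricize_sideMul,
    Matrix.transpose_mul, Matrix.transpose_mul, hA, hB, Matrix.mul_assoc, Matrix.trace_mul_comm]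
  simp only [Matrix.mul_assoc]

/-- The product along all modes with square matrices, as a linear map. -/
def modeProdEnd (B : ∀ k, Matrix (Fin (p k)) (Fin (p k)) ℝ) : Module.End ℝ (Tensor p) where
  toFun X := modeProd X B
  map_add' X Y := by
    ext i
    simp [modeProd, add_mul, Finset.sum_add_distrib]
  map_smul' c X := by
    ext i
    simp [modeProd, Finset.mul_sum, mul_assoc]

theorem modeProdEnd_apply (B : ∀ k, Matrix (Fin (p k)) (Fin (p k)) ℝ) (X : Tensor p) :
    modeProdEnd B X = modeProd X B := rfl

theorem modeProdEnd_eq_sideMul (k : Fin s) (B : ∀ k, Matrix (Fin (p k)) (Fin (p k)) ℝ) :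
    modeProdEnd B = sideMul k (B k) (kron fun j : {j : Fin s // j ≠ k} => B j)ᵀ := by
  ext1 X
  rw [sideMul_apply, ← matricize_modeProd, tensorize_matricize, modeProdEnd_apply]

theorem modeProd_eq_toLp (X : Tensor p) (B : ∀ k, Matrix (Fin (q k)) (Fin (p k)) ℝ) :
    modeProd X B = WithLp.toLp 2 (kron B *ᵥ X) := by
  ext j
  simp only [modeProd, kron, Matrix.mulVec, dotProduct, Matrix.of_apply]
  exact Finset.sum_congr rfl fun i _ => mul_comm _ _

theorem modeProd_modeProd (X : Tensor p) (B : ∀ k, Matrix (Fin (q k)) (Fin (p k)) ℝ)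
    (C : ∀ k, Matrix (Fin (r k)) (Fin (q k)) ℝ) :
    modeProd (modeProd X B) C = modeProd X fun k => C k * B k := by
  simp only [modeProd_eq_toLp]
  rw [Matrix.mulVec_mulVec, kron_mul]

theorem modeProd_one (X : Tensor p) : modeProd X (fun _ => 1) = X := by
  rw [modeProd_eq_toLp, kron_one, Matrix.one_mulVec]

theorem modeProdEnd_isSymmetricProjection {P : ∀ k, Matrix (Fin (p k)) (Fin (p k)) ℝ}
    (h : ∀ k, IsOrthProj (P k)) : (modeProdEnd P).IsSymmetricProjection := by
  refine ⟨?_, fun X Y => ?_⟩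
  · ext1 X
    rw [Module.End.mul_apply, modeProdEnd_apply, modeProdEnd_apply, modeProd_modeProd]
    simp only [(h _).idem]
  · have hs : (kron P)ᵀ = kron P := (IsOrthProj.kron h).symm
    simp only [modeProdEnd_apply, modeProd_eq_toLp, EuclideanSpace.inner_eq_star_dotProduct,
      star_trivial]
    rw [Matrix.dotProduct_mulVec, ← Matrix.mulVec_transpose, hs]

theorem LinearMap.IsSymmetricProjection.norm_sq {E : Type*} [NormedAddCommGroup E]
    [InnerProductSpace ℝ E] {T : Module.End ℝ E} (h : T.IsSymmetricProjection) (x : E) :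
    ‖x - T x‖ ^ 2 = ‖x‖ ^ 2 - ‖T x‖ ^ 2 := by
  have h1 : inner ℝ x (T x) = ‖T x‖ ^ 2 := by
    rw [← real_inner_self_eq_norm_sq, h.isSymmetric, ← Module.End.mul_apply, h.isIdempotentElem.eq]
  rw [norm_sub_sq_real, h1]
  ring

/-! ### Projecting one mode at a time. -/

/-- The first `i` factors of `P`, and identity matrices for the remaining modes. -/
def headFactors (P : ∀ k, Matrix (Fin (p k)) (Fin (p k)) ℝ) (i : ℕ) :
    ∀ k, Matrix (Fin (p k)) (Fin (p k)) ℝ :=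
  fun l => if (l : ℕ) < i then P l else 1

theorem headFactors_isOrthProj {P : ∀ k, Matrix (Fin (p k)) (Fin (p k)) ℝ}
    (h : ∀ k, IsOrthProj (P k)) (i : ℕ) (k : Fin s) : IsOrthProj (headFactors P i k) := by
  unfold headFactors
  split_ifs
  exacts [h k, IsOrthProj.one]

theorem headFactors_zero (P : ∀ k, Matrix (Fin (p k)) (Fin (p k)) ℝ) :
    headFactors P 0 = fun _ => 1 := by
  funext k
  simp [headFactors]

theorem headFactors_self (P : ∀ k, Matrix (Fin (p k)) (Fin (p k)) ℝ) : headFactors P s = P := by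
  funext k
  simp [headFactors]

theorem modeProdEnd_headFactors (P : ∀ k, Matrix (Fin (p k)) (Fin (p k)) ℝ) (k : Fin s) :
    modeProdEnd (headFactors P k) =
      sideMul k 1 (kron fun j : {j : Fin s // j ≠ k} => headFactors P k j)ᵀ := by
  rw [modeProdEnd_eq_sideMul k]
  simp [headFactors]

/-- Passing from `k` to `k + 1` head factors changes only the factor of mode `k`, which acts on the
mode-`k` unfolding from the left; the right factor is unchanged. -/
theorem modeProdEnd_headFactors_succ (P : ∀ k, Matrix (Fin (p k)) (Fin (p k)) ℝ) (k : Fin s) :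
    modeProdEnd (headFactors P (k + 1)) =
      sideMul k (P k) (kron fun j : {j : Fin s // j ≠ k} => headFactors P k j)ᵀ := by
  rw [modeProdEnd_eq_sideMul k]
  have h : ∀ j : {j : Fin s // j ≠ k}, headFactors P (k + 1) j = headFactors P k j := by
    intro j
    have hj : ((j : Fin s) : ℕ) ≠ k := fun h => j.2 (Fin.ext h)
    have : ((j : Fin s) : ℕ) < k + 1 ↔ ((j : Fin s) : ℕ) < k := by omega
    simp [headFactors, this]
  simp only [h]
  simp [headFactors]

/-- The `k`-th term of the telescoping sum for `X - X ×_1 P_1 ⋯ ×_s P_s`. -/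
def headDiff (P : ∀ k, Matrix (Fin (p k)) (Fin (p k)) ℝ) (k : Fin s) : Module.End ℝ (Tensor p) :=
  sideMul k (1 - P k) (kron fun j : {j : Fin s // j ≠ k} => headFactors P k j)ᵀ

theorem headDiff_eq (P : ∀ k, Matrix (Fin (p k)) (Fin (p k)) ℝ) (k : Fin s) :
    headDiff P k = modeProdEnd (headFactors P k) - modeProdEnd (headFactors P (k + 1)) := by
  rw [headDiff, sideMul_sub_left, ← modeProdEnd_headFactors, ← modeProdEnd_headFactors_succ]

theorem sub_modeProd_eq_sum (P : ∀ k, Matrix (Fin (p k)) (Fin (p k)) ℝ) (X : Tensor p) :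
    X - modeProd X P = ∑ k, headDiff P k X := by
  simp only [headDiff_eq]
  rw [Fin.sum_univ_eq_sum_range (fun i => (modeProdEnd (headFactors P i) -
    modeProdEnd (headFactors P (i + 1))) X) s]
  simp only [LinearMap.sub_apply]
  rw [Finset.sum_range_sub' (fun i => modeProdEnd (headFactors P i) X), headFactors_zero,
    headFactors_self, modeProdEnd_apply, modeProdEnd_apply, modeProd_one]

/-- The head products are nested orthogonal projections, so Pythagoras applies at each step and the
squared norms telescope. The gain over the triangle inequality is the factor `√s` instead of `s` in
the truncation error. -/
theorem norm_sq_sub_modeProd {P : ∀ k, Matrix (Fin (p k)) (Fin (p k)) ℝ}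
    (h : ∀ k, IsOrthProj (P k)) (X : Tensor p) :
    ‖X - modeProd X P‖ ^ 2 = ∑ k, ‖headDiff P k X‖ ^ 2 := by
  have h1 : ∀ k : Fin s, ‖headDiff P k X‖ ^ 2 = ‖modeProdEnd (headFactors P k) X‖ ^ 2 -
      ‖modeProdEnd (headFactors P (k + 1)) X‖ ^ 2 := by
    intro k
    have h2 : modeProdEnd (headFactors P (k + 1)) X =
        modeProdEnd (headFactors P (k + 1)) (modeProdEnd (headFactors P k) X) := by
      have hQ := (IsOrthProj.kron fun j : {j : Fin s // j ≠ k} => headFactors_isOrthProj h k j)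
      rw [modeProdEnd_headFactors, modeProdEnd_headFactors_succ, ← Module.End.mul_apply,
        sideMul_mul, Matrix.mul_one, hQ.symm, hQ.idem]
    rw [headDiff_eq, LinearMap.sub_apply, h2]
    exact (modeProdEnd_isSymmetricProjection (headFactors_isOrthProj h _)).norm_sq _
  simp only [h1]
  rw [Fin.sum_univ_eq_sum_range (fun i => ‖modeProdEnd (headFactors P i) X‖ ^ 2 -
    ‖modeProdEnd (headFactors P (i + 1)) X‖ ^ 2) s,
    Finset.sum_range_sub' (fun i => ‖modeProdEnd (headFactors P i) X‖ ^ 2), headFactors_zero,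
    headFactors_self, modeProdEnd_apply, modeProdEnd_apply, modeProd_one]
  exact (modeProdEnd_isSymmetricProjection h).norm_sq X

/-! ### Quasi-optimality of the truncated and sequentially truncated HOSVD. -/

theorem tuckerRank_modeProd_le (X : Tensor p) (B : ∀ k, Matrix (Fin (q k)) (Fin (p k)) ℝ) :
    tuckerRank (modeProd X B) ≤ tuckerRank X := by
  intro k
  rw [tuckerRank, matricize_modeProd]
  exact (Matrix.rank_mul_le_left _ _).trans (Matrix.rank_mul_le_right _ _)

theorem rank_proj_le {a b : Type*} [Fintype a] [Fintype b] (U : Matrix a b ℝ) :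
    (proj U).rank ≤ Fintype.card b :=
  (Matrix.rank_mul_le_left _ _).trans (Matrix.rank_le_card_width _)

theorem tuckerRank_modeProd_proj_le (X : Tensor p) (U : ∀ k, Matrix (Fin (p k)) (Fin (r k)) ℝ) :
    tuckerRank (modeProd X fun k => proj (U k)) ≤ r := by
  intro k
  rw [tuckerRank, matricize_modeProd]
  refine (Matrix.rank_mul_le_left _ _).trans ((Matrix.rank_mul_le_left _ _).trans ?_)
  simpa using rank_proj_le (U k)

theorem norm_sub_modeProd_le {P : ∀ k, Matrix (Fin (p k)) (Fin (p k)) ℝ}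
    (h : ∀ k, IsOrthProj (P k)) (X B : Tensor p) (hle : ∀ k, ‖headDiff P k X‖ ≤ ‖X - B‖) :
    ‖X - modeProd X P‖ ≤ √s * ‖X - B‖ := by
  refine le_of_sq_le_sq ?_ (by positivity)
  rw [norm_sq_sub_modeProd h, mul_pow, Real.sq_sqrt (Nat.cast_nonneg s)]
  refine (Finset.sum_le_sum fun k _ => pow_le_pow_left₀ (norm_nonneg _) (hle k) 2).trans ?_
  simp

theorem IsTHOSVD.tuckerRank_le {Y Y' : Tensor p} (h : IsTHOSVD r Y Y') : tuckerRank Y' ≤ r := by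
  obtain ⟨U, -, rfl⟩ := h
  exact tuckerRank_modeProd_proj_le _ _

theorem IsSTHOSVD.tuckerRank_le {Y Y' : Tensor p} (h : IsSTHOSVD r Y Y') : tuckerRank Y' ≤ r := by
  obtain ⟨U, -, rfl⟩ := h
  exact tuckerRank_modeProd_proj_le _ _

/-- In each telescoping term the Kronecker projector on the right is a contraction; what remains is
a best approximation error of the unfolding of `Y`, which `B` cannot beat. -/
theorem IsTHOSVD.norm_sub_le {Y Y' : Tensor p} (h : IsTHOSVD r Y Y') (B : Tensor p)
    (hB : tuckerRank B ≤ r) : ‖Y - Y'‖ ≤ √s * ‖Y - B‖ := by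
  obtain ⟨U, hU, rfl⟩ := h
  have hP : ∀ k, IsOrthProj (proj (U k)) := fun k => IsOrthProj.proj (hU k).transpose_mul_self
  refine norm_sub_modeProd_le hP _ _ fun k => le_of_sq_le_sq ?_ (norm_nonneg _)
  have hQ := IsOrthProj.kron fun j : {j : Fin s // j ≠ k} => headFactors_isOrthProj hP k j
  rw [norm_sq_eq_frobSq k, norm_sq_eq_frobSq k, headDiff, matricize_sideMul, hQ.symm, matricize_sub]
  exact (hQ.frobSq_mul_le_right _).trans ((hU k).frobSq_le _ (hB k))

/-- Here the SVD is that of the already projected tensor, so the competitor is `B` under the same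
projections, which do not raise its rank. The contraction is discarded after comparing. -/
theorem IsSTHOSVD.norm_sub_le {Y Y' : Tensor p} (h : IsSTHOSVD r Y Y') (B : Tensor p)
    (hB : tuckerRank B ≤ r) : ‖Y - Y'‖ ≤ √s * ‖Y - B‖ := by
  obtain ⟨U, hU, rfl⟩ := h
  have hP : ∀ k, IsOrthProj (proj (U k)) := fun k => IsOrthProj.proj (hU k).transpose_mul_self
  refine norm_sub_modeProd_le hP _ _ fun k => le_of_sq_le_sq ?_ (norm_nonneg _)
  have hQ := IsOrthProj.kron fun j : {j : Fin s // j ≠ k} => headFactors_isOrthProj hP k j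
  have hm : ∀ Z : Tensor p,
      matricize k (modeProd Z fun l => if l < k then proj (U l) else 1) =
        matricize k Z * kron fun j : {j : Fin s // j ≠ k} => headFactors (fun k => proj (U k)) k j := by
    intro Z
    rw [← Matrix.one_mul (matricize k Z), ← hQ.symm, ← matricize_sideMul, ← modeProdEnd_headFactors]
    rfl
  have h1 := (hU k).frobSq_le (matricize k (modeProd B fun l => if l < k then proj (U l) else 1))
    ((tuckerRank_modeProd_le B _ k).trans (hB k))
  rw [hm, hm, ← Matrix.sub_mul, ← Matrix.mul_assoc] at h1
  rw [norm_sq_eq_frobSq k, norm_sq_eq_frobSq k, headDiff, matricize_sideMul, hQ.symm, matricize_sub]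
  exact h1.trans (hQ.frobSq_mul_le_right _)

end TensorLemmas

/-! ### The tangent space projector and its normal component. -/

section TangentSpace

open Matrix

variable {s : ℕ} {p r : Fin s → ℕ}

theorem kron_mul_rowFactor (k : Fin s) (A : ∀ k, Matrix (Fin (p k)) (Fin (p k)) ℝ)
    (U : ∀ k, Matrix (Fin (p k)) (Fin (r k)) ℝ) (V : Matrix (OtherModes r k) (Fin (r k)) ℝ)
    (h : ∀ j ≠ k, A j * U j = U j) :
    (kron fun j : {j : Fin s // j ≠ k} => A j) * rowFactor U k V = rowFactor U k V := by
  have h1 : rowFactor U k V = (kron fun j : {j : Fin s // j ≠ k} => U j) * V := rfl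
  rw [h1, ← Matrix.mul_assoc, kron_mul]
  congr 2
  funext j
  exact h j j.2

theorem kron_mul_proj_rowFactor (k : Fin s) (A : ∀ k, Matrix (Fin (p k)) (Fin (p k)) ℝ)
    (U : ∀ k, Matrix (Fin (p k)) (Fin (r k)) ℝ) (V : Matrix (OtherModes r k) (Fin (r k)) ℝ)
    (h : ∀ j ≠ k, A j * U j = U j) :
    (kron fun j : {j : Fin s // j ≠ k} => A j) * proj (rowFactor U k V) =
      proj (rowFactor U k V) := by
  rw [proj, ← Matrix.mul_assoc, kron_mul_rowFactor k A U V h]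

theorem matrix_rank_add_le {a b : Type*} [Fintype a] [Fintype b] (M N : Matrix a b ℝ) :
    (M + N).rank ≤ M.rank + N.rank := by
  rw [Matrix.rank, Matrix.mulVecLin_add]
  exact (Submodule.finrank_mono (LinearMap.range_add_le _ _)).trans
    (Submodule.finrank_add_le_finrank_add_finrank _ _)

theorem proj_mul_self {a b : Type*} [Fintype a] [Fintype b] [DecidableEq b] {U : Matrix a b ℝ}
    (h : Uᵀ * U = 1) : proj U * U = U := by
  rw [proj, Matrix.mul_assoc, h, Matrix.mul_one]

theorem rowFactor_transpose_mul_self (k : Fin s) {U : ∀ k, Matrix (Fin (p k)) (Fin (r k)) ℝ}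
    {V : Matrix (OtherModes r k) (Fin (r k)) ℝ} (hU : ∀ k, (U k)ᵀ * U k = 1) (hV : Vᵀ * V = 1) :
    (rowFactor U k V)ᵀ * rowFactor U k V = 1 := by
  have h1 : rowFactor U k V = (kron fun j : {j : Fin s // j ≠ k} => U j) * V := rfl
  have h2 : (kron fun j : {j : Fin s // j ≠ k} => U j)ᵀ *
      (kron fun j : {j : Fin s // j ≠ k} => U j) = 1 := by
    rw [kron_transpose, kron_mul]
    simp only [hU]
    exact kron_one
  rw [h1, Matrix.transpose_mul, Matrix.mul_assoc, ← Matrix.mul_assoc _ _ V, h2, Matrix.one_mul, hV]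

/-- The summand of the tangent space projector that belongs to the mode `k`. -/
def tangentTerm (U : ∀ k, Matrix (Fin (p k)) (Fin (r k)) ℝ)
    (V : ∀ k, Matrix (OtherModes r k) (Fin (r k)) ℝ) (k : Fin s) : Module.End ℝ (Tensor p) :=
  sideMul k (1 - proj (U k)) (proj (rowFactor U k (V k)))

/-- The tangent space projector as a linear map. -/
def tangentEnd (U : ∀ k, Matrix (Fin (p k)) (Fin (r k)) ℝ)
    (V : ∀ k, Matrix (OtherModes r k) (Fin (r k)) ℝ) : Module.End ℝ (Tensor p) :=
  modeProdEnd (fun k => proj (U k)) + ∑ k, tangentTerm U V k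

theorem tangentEnd_apply (U : ∀ k, Matrix (Fin (p k)) (Fin (r k)) ℝ)
    (V : ∀ k, Matrix (OtherModes r k) (Fin (r k)) ℝ) (Z : Tensor p) :
    tangentEnd U V Z = tangentProj U V Z := by
  rw [tangentEnd, LinearMap.add_apply, LinearMap.sum_apply]
  rfl

variable {U : ∀ k, Matrix (Fin (p k)) (Fin (r k)) ℝ}
  {V : ∀ k, Matrix (OtherModes r k) (Fin (r k)) ℝ}

theorem proj_transpose {a b : Type*} [Fintype b] (U : Matrix a b ℝ) : (proj U)ᵀ = proj U := by
  simp [proj]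

/-- The columns of `W_l` lie in the span of the Kronecker product of the `U j`, `j ≠ l`, which
contains the factor `U k`. Hence distinct tangent terms are orthogonal: the `k`-th one contains `1 -
P_{U_k}`. -/
theorem sideMul_proj_mul_tangentTerm (hU : ∀ k, (U k)ᵀ * U k = 1) {k l : Fin s} (hkl : k ≠ l) :
    sideMul k (proj (U k)) 1 * tangentTerm U V l = tangentTerm U V l := by
  let A : ∀ j, Matrix (Fin (p j)) (Fin (p j)) ℝ := Function.update (fun _ => 1) k (proj (U k))
  have hAk : A k = proj (U k) := Function.update_self ..
  have hA : ∀ j ≠ k, A j = 1 := fun j hj => Function.update_of_ne hj ..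
  have h2 : sideMul k (proj (U k)) 1 = modeProdEnd A := by
    have h3 : (fun j : {j : Fin s // j ≠ k} => A j) = fun _ => 1 := funext fun j => hA j j.2
    rw [modeProdEnd_eq_sideMul k, h3, kron_one, Matrix.transpose_one, hAk]
  have h4 : ∀ j ≠ l, A j * U j = U j := by
    intro j _
    rcases eq_or_ne j k with rfl | hj
    · rw [hAk, proj_mul_self (hU j)]
    · rw [hA j hj, Matrix.one_mul]
  rw [h2, modeProdEnd_eq_sideMul l, tangentTerm, sideMul_mul, hA l hkl.symm, Matrix.one_mul]
  congr 1
  rw [← proj_transpose, ← Matrix.transpose_mul, kron_mul_proj_rowFactor l A U (V l) h4]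

theorem modeProdEnd_mul_tangentTerm (hU : ∀ k, (U k)ᵀ * U k = 1) (k : Fin s) :
    modeProdEnd (fun k => proj (U k)) * tangentTerm U V k = 0 := by
  rw [modeProdEnd_eq_sideMul k, tangentTerm, sideMul_mul, Matrix.mul_sub, Matrix.mul_one,
    (IsOrthProj.proj (hU k)).idem, sub_self, sideMul_zero_left]

theorem tangentTerm_mul_sideMul_proj (hU : ∀ k, (U k)ᵀ * U k = 1) (k : Fin s)
    (B : Matrix (OtherModes p k) (OtherModes p k) ℝ) :
    tangentTerm U V k * sideMul k (proj (U k)) B = 0 := by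
  rw [tangentTerm, sideMul_mul, Matrix.sub_mul, Matrix.one_mul,
    (IsOrthProj.proj (hU k)).idem, sub_self, sideMul_zero_left]

theorem tangentTerm_mul_modeProdEnd (hU : ∀ k, (U k)ᵀ * U k = 1) (k : Fin s) :
    tangentTerm U V k * modeProdEnd (fun k => proj (U k)) = 0 := by
  rw [modeProdEnd_eq_sideMul k, tangentTerm_mul_sideMul_proj hU]

theorem tangentTerm_mul_of_ne (hU : ∀ k, (U k)ᵀ * U k = 1) {k l : Fin s} (hkl : k ≠ l) :
    tangentTerm U V k * tangentTerm U V l = 0 := by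
  rw [← sideMul_proj_mul_tangentTerm hU hkl, ← mul_assoc, tangentTerm_mul_sideMul_proj hU, zero_mul]

theorem tangentTerm_mul_self (hU : ∀ k, (U k)ᵀ * U k = 1) (hV : ∀ k, (V k)ᵀ * V k = 1)
    (k : Fin s) : tangentTerm U V k * tangentTerm U V k = tangentTerm U V k := by
  rw [tangentTerm, sideMul_mul, (IsOrthProj.proj (hU k)).one_sub.idem,
    (IsOrthProj.proj (rowFactor_transpose_mul_self k hU (hV k))).idem]

theorem tangentEnd_isSymmetricProjection (hU : ∀ k, (U k)ᵀ * U k = 1)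
    (hV : ∀ k, (V k)ᵀ * V k = 1) : (tangentEnd U V).IsSymmetricProjection := by
  have hM := modeProdEnd_isSymmetricProjection fun k => IsOrthProj.proj (hU k)
  refine ⟨?_, fun X Y => ?_⟩
  · rw [IsIdempotentElem, tangentEnd, add_mul, mul_add, mul_add, hM.isIdempotentElem.eq,
      Finset.mul_sum, Finset.sum_mul, Finset.sum_mul_sum]
    have h1 : ∀ k, ∑ l, tangentTerm U V k * tangentTerm U V l = tangentTerm U V k := by
      intro k
      rw [Finset.sum_eq_single k, tangentTerm_mul_self hU hV]
      · exact fun l _ hl => tangentTerm_mul_of_ne hU hl.symm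
      · simp
    simp [h1, modeProdEnd_mul_tangentTerm hU, tangentTerm_mul_modeProdEnd hU]
  · have h1 : ∀ k, inner ℝ (tangentTerm U V k X) Y = inner ℝ X (tangentTerm U V k Y) := fun k =>
      sideMul_isSymmetric (IsOrthProj.proj (hU k)).one_sub.symm (proj_transpose _) X Y
    rw [tangentEnd, LinearMap.add_apply, LinearMap.add_apply, LinearMap.sum_apply,
      LinearMap.sum_apply, inner_add_left, inner_add_right, sum_inner, inner_sum, hM.isSymmetric X Y]
    simp only [h1]

/-- All other summands are already fixed by `P_{U_k}` in mode `k`. So a tangent tensor has mode-`k`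
unfolding with one part of rank `r k` inside the range of `U k` and one of rank `r k` outside,
whence the rank bound `2 * r k`. -/
theorem sideMul_one_sub_mul_tangentEnd (hU : ∀ k, (U k)ᵀ * U k = 1) (k : Fin s) :
    sideMul k (1 - proj (U k)) 1 * tangentEnd U V = tangentTerm U V k := by
  have h1 : ∀ l ≠ k, sideMul k (1 - proj (U k)) 1 * tangentTerm U V l = 0 := by
    intro l hl
    rw [sideMul_sub_left, sub_mul, sideMul_proj_mul_tangentTerm hU hl.symm, sideMul_one, one_mul,
      sub_self]
  have h2 : sideMul k (1 - proj (U k)) 1 * modeProdEnd (fun k => proj (U k)) = 0 := by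
    rw [modeProdEnd_eq_sideMul k, sideMul_mul, Matrix.sub_mul, (IsOrthProj.proj (hU k)).idem,
      Matrix.one_mul, sub_self, sideMul_zero_left]
  rw [tangentEnd, mul_add, h2, zero_add, Finset.mul_sum,
    Finset.sum_eq_single k (fun l _ hl => h1 l hl) (by simp), tangentTerm, sideMul_mul,
    (IsOrthProj.proj (hU k)).one_sub.idem, Matrix.mul_one]

theorem tuckerRank_tangentEnd_le (hU : ∀ k, (U k)ᵀ * U k = 1) (Z : Tensor p) :
    tuckerRank (tangentEnd U V Z) ≤ fun k => 2 * r k := by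
  intro k
  have h1 : matricize k (tangentEnd U V Z) = proj (U k) * matricize k (tangentEnd U V Z) +
      (1 - proj (U k)) * matricize k Z * proj (rowFactor U k (V k)) := by
    have h2 := congrArg (matricize k)
      (LinearMap.congr_fun (sideMul_one_sub_mul_tangentEnd (V := V) hU k) Z)
    rw [Module.End.mul_apply, tangentTerm, matricize_sideMul, matricize_sideMul, Matrix.mul_one] at h2
    rw [← h2, ← Matrix.add_mul, add_sub_cancel, Matrix.one_mul]
  change (matricize k (tangentEnd U V Z)).rank ≤ 2 * r k
  rw [h1, two_mul]
  refine (matrix_rank_add_le _ _).trans (add_le_add ?_ ?_)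
  · simpa using (Matrix.rank_mul_le_left _ _).trans (rank_proj_le (U k))
  · simpa using (Matrix.rank_mul_le_right _ _).trans (rank_proj_le (rowFactor U k (V k)))

theorem IsTuckerFrame.orthonormal_left {X : Tensor p} (h : IsTuckerFrame X U V) (k : Fin s) :
    (U k)ᵀ * U k = 1 := (h.1 k).transpose_mul_self

theorem IsTuckerFrame.orthonormal_right {X : Tensor p} (h : IsTuckerFrame X U V) (k : Fin s) :
    (V k)ᵀ * V k = 1 := (h.2 k).1

theorem IsTuckerFrame.proj_mul {X : Tensor p} (h : IsTuckerFrame X U V) (hX : tuckerRank X ≤ r)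
    (k : Fin s) : proj (U k) * matricize k X = matricize k X := (h.1 k).proj_mul_self (hX k)

theorem one_sub_mul_eq_zero {a b : Type*} [Fintype a] [DecidableEq a] {P : Matrix a a ℝ}
    {M : Matrix a b ℝ} (h : P * M = M) : (1 - P) * M = 0 := by
  rw [Matrix.sub_mul, Matrix.one_mul, h, sub_self]

theorem IsTuckerFrame.modeProd_proj {X : Tensor p} (h : IsTuckerFrame X U V)
    (hX : tuckerRank X ≤ r) : modeProd X (fun k => proj (U k)) = X := by
  symm
  rw [← sub_eq_zero, sub_modeProd_eq_sum]
  refine Finset.sum_eq_zero fun k _ => ?_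
  rw [headDiff, sideMul_apply, one_sub_mul_eq_zero (h.proj_mul hX k), Matrix.zero_mul]
  rfl

/-- Unfolding `X = S ×_1 U_1 ⋯ ×_s U_s` and inserting the QR decomposition of the core gives `U_k Rᵀ
W_kᵀ`. The unfolding may have rank below `r k`, since `R` need not be invertible. -/
theorem IsTuckerFrame.mul_proj_rowFactor {X : Tensor p} (h : IsTuckerFrame X U V)
    (hX : tuckerRank X ≤ r) (k : Fin s) :
    matricize k X * proj (rowFactor U k (V k)) = matricize k X := by
  have h1 := h.modeProd_proj hX
  simp only [proj] at h1
  rw [← modeProd_modeProd] at h1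
  obtain ⟨-, R, -, hR⟩ := h.2 k
  have h2 : matricize k X = U k * Rᵀ * (rowFactor U k (V k))ᵀ := by
    rw [← Matrix.transpose_inj, Matrix.transpose_transpose, Matrix.transpose_mul] at hR
    conv_lhs => rw [← h1]
    rw [matricize_modeProd, hR]
    have h3 : rowFactor U k (V k) = (kron fun j : {j : Fin s // j ≠ k} => U j) * V k := rfl
    rw [h3, Matrix.transpose_mul]
    simp only [Matrix.mul_assoc]
  rw [h2, proj, Matrix.mul_assoc, ← Matrix.mul_assoc _ (rowFactor U k (V k)),
    rowFactor_transpose_mul_self k h.orthonormal_left (h.orthonormal_right k), Matrix.one_mul]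

theorem IsTuckerFrame.tangentEnd_self {X : Tensor p} (h : IsTuckerFrame X U V)
    (hX : tuckerRank X ≤ r) : tangentEnd U V X = X := by
  rw [tangentEnd, LinearMap.add_apply, modeProdEnd_apply, h.modeProd_proj hX, LinearMap.sum_apply,
    Finset.sum_eq_zero, add_zero]
  intro k _
  rw [tangentTerm, sideMul_apply, one_sub_mul_eq_zero (h.proj_mul hX k), Matrix.zero_mul]
  rfl

/-- The component of a tensor normal to the tangent space at `X` is of second order in the
distance to `X`. -/
theorem IsTuckerFrame.norm_normal_le {X : Tensor p} (h : IsTuckerFrame X U V)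
    (hX : tuckerRank X ≤ r) (Xs : Tensor p) {lam : ℝ} (hlam : 0 ≤ lam)
    (hle : ∀ k, lam ≤ sigma (matricize k Xs) (matricize k Xs).rank) :
    lam * ‖Xs - tangentEnd U V Xs‖ ≤ s * ‖X - Xs‖ ^ 2 := by
  have hU := h.orthonormal_left
  have hP : ∀ k, IsOrthProj (proj (U k)) := fun k => IsOrthProj.proj (hU k)
  let Q : ∀ k, Matrix (OtherModes p k) (OtherModes p k) ℝ := fun k =>
    kron fun j : {j : Fin s // j ≠ k} => headFactors (fun k => proj (U k)) k j
  let W : ∀ k, Matrix (OtherModes p k) (OtherModes p k) ℝ := fun k => proj (rowFactor U k (V k))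
  have hQ : ∀ k, IsOrthProj (Q k) := fun k =>
    IsOrthProj.kron fun j : {j : Fin s // j ≠ k} => headFactors_isOrthProj hP k j
  have hQW : ∀ k, Q k * W k = W k := by
    refine fun k => kron_mul_proj_rowFactor k _ U (V k) fun j _ => ?_
    unfold headFactors
    split_ifs
    · exact proj_mul_self (hU j)
    · exact Matrix.one_mul _
  have hW : ∀ k, IsOrthProj (W k) := fun k =>
    IsOrthProj.proj (rowFactor_transpose_mul_self k hU (h.orthonormal_right k))
  have hWQ : ∀ k, W k * Q k = W k := by
    intro k
    have := congrArg Matrix.transpose (hQW k)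
    rwa [Matrix.transpose_mul, (hQ k).symm, (hW k).symm] at this
  -- The telescoping sum for `Xs - Xs ×_1 P_{U_1} ⋯ ×_s P_{U_s}` has right factors `Q k`, and the
  -- tangent terms have the same left factors with `W k`. They combine mode by mode, and `Q k - W k`
  -- is again a projection.
  have h1 : Xs - tangentEnd U V Xs = ∑ k, sideMul k (1 - proj (U k)) (Q k - W k) Xs := by
    rw [tangentEnd, LinearMap.add_apply, ← sub_sub, modeProdEnd_apply, sub_modeProd_eq_sum,
      LinearMap.sum_apply, ← Finset.sum_sub_distrib]
    refine Finset.sum_congr rfl fun k _ => ?_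
    rw [sideMul_sub_right, LinearMap.sub_apply, headDiff, (hQ k).symm]
    rfl
  have h2 : ∀ k, lam * ‖sideMul k (1 - proj (U k)) (Q k - W k) Xs‖ ≤ ‖X - Xs‖ ^ 2 := by
    intro k
    refine le_of_sq_le_sq ?_ (by positivity)
    -- Both outer factors annihilate the unfolding of `X`, so each one-sided product sees only `X -
    -- Xs`. Two such factors make the bound quadratic.
    have h3 : (1 - proj (U k)) * matricize k Xs = -((1 - proj (U k)) * matricize k (X - Xs)) := by
      rw [matricize_sub, Matrix.mul_sub, one_sub_mul_eq_zero (h.proj_mul hX k), zero_sub, neg_neg]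
    have h4 : matricize k Xs * (Q k - W k) = -(matricize k (X - Xs) * (Q k - W k)) := by
      have h5 : matricize k X * (Q k - W k) = 0 := by
        rw [← h.mul_proj_rowFactor hX k, Matrix.mul_assoc, Matrix.mul_sub]
        have h6 : proj (rowFactor U k (V k)) * Q k = W k := hWQ k
        have h7 : proj (rowFactor U k (V k)) * W k = W k := (hW k).idem
        rw [h6, h7, sub_self, Matrix.mul_zero]
      rw [matricize_sub, Matrix.sub_mul, h5, zero_sub, neg_neg]
    have h8 := sigma_sq_mul_frobSq_le (1 - proj (U k)) (matricize k Xs) (Q k - W k)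
    have h9 : frobSq ((1 - proj (U k)) * matricize k Xs) ≤ ‖X - Xs‖ ^ 2 := by
      rw [h3, frobSq_neg, norm_sq_eq_frobSq k]
      exact (hP k).one_sub.frobSq_mul_le _
    have h10 : frobSq (matricize k Xs * (Q k - W k)) ≤ ‖X - Xs‖ ^ 2 := by
      rw [h4, frobSq_neg, norm_sq_eq_frobSq k]
      exact ((hQ k).sub (hW k) (hQW k)).frobSq_mul_le_right _
    rw [mul_pow, norm_sq_eq_frobSq k (sideMul k _ _ Xs), matricize_sideMul]
    calc _ ≤ sigma (matricize k Xs) (matricize k Xs).rank ^ 2 *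
          frobSq ((1 - proj (U k)) * matricize k Xs * (Q k - W k)) :=
          mul_le_mul_of_nonneg_right (pow_le_pow_left₀ hlam (hle k) 2) (frobSq_nonneg _)
      _ ≤ ‖X - Xs‖ ^ 2 * ‖X - Xs‖ ^ 2 :=
          h8.trans (mul_le_mul h9 h10 (frobSq_nonneg _) (sq_nonneg _))
      _ = _ := by ring
  rw [h1]
  calc _ ≤ lam * ∑ k, ‖sideMul k (1 - proj (U k)) (Q k - W k) Xs‖ :=
        mul_le_mul_of_nonneg_left (norm_sum_le _ _) hlam
    _ ≤ ∑ _k : Fin s, ‖X - Xs‖ ^ 2 := by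
        rw [Finset.mul_sum]
        exact Finset.sum_le_sum fun k _ => h2 k
    _ = _ := by simp

end TangentSpace

/-! ### One projected gradient step with exact line search under restricted isometry. -/

section ProjectedGradientStep

variable {E F : Type*} [NormedAddCommGroup E] [InnerProductSpace ℝ E] [NormedAddCommGroup F]
  [InnerProductSpace ℝ F]

/-- Polarization of a bound on the quadratic form `x ↦ β ‖x‖² - α ‖L x‖²`. -/
theorem abs_inner_sub_inner_le (L : E →ₗ[ℝ] F) {α β c : ℝ} {z w : E}
    (h : ∀ a b : ℝ, |β * ‖a • z + b • w‖ ^ 2 - α * ‖L (a • z + b • w)‖ ^ 2| ≤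
      c * ‖a • z + b • w‖ ^ 2) :
    |β * inner ℝ z w - α * inner ℝ (L z) (L w)| ≤ c * (‖z‖ * ‖w‖) := by
  rcases eq_or_ne z 0 with rfl | hz
  · simp
  rcases eq_or_ne w 0 with rfl | hw
  · simp
  have hpos : 0 < ‖z‖ * ‖w‖ := mul_pos (norm_pos_iff.mpr hz) (norm_pos_iff.mpr hw)
  have key : ∀ a b : ℝ, ‖a • z + b • w‖ ^ 2 =
      a ^ 2 * ‖z‖ ^ 2 + 2 * (a * b * inner ℝ z w) + b ^ 2 * ‖w‖ ^ 2 := by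
    intro a b
    rw [norm_add_sq_real, norm_smul, norm_smul, mul_pow, mul_pow, inner_smul_left, inner_smul_right]
    simp only [conj_trivial, Real.norm_eq_abs, sq_abs]
    ring
  have keyL : ∀ a b : ℝ, ‖L (a • z + b • w)‖ ^ 2 =
      a ^ 2 * ‖L z‖ ^ 2 + 2 * (a * b * inner ℝ (L z) (L w)) + b ^ 2 * ‖L w‖ ^ 2 := by
    intro a b
    rw [map_add, map_smul, map_smul, norm_add_sq_real, norm_smul, norm_smul, mul_pow, mul_pow,
      inner_smul_left, inner_smul_right]
    simp only [conj_trivial, Real.norm_eq_abs, sq_abs]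
    ring
  -- The vectors `‖w‖ z` and `±‖z‖ w` have equal length. Subtracting the two bounds isolates the
  -- cross terms, while the squared norms of the two combinations add up to `4 ‖z‖² ‖w‖²`.
  have h1 := abs_le.mp (h ‖w‖ ‖z‖)
  have h2 := abs_le.mp (h ‖w‖ (-‖z‖))
  rw [key, keyL] at h1 h2
  rw [abs_le]
  constructor <;> refine le_of_mul_le_mul_left ?_ hpos <;> nlinarith

variable [FiniteDimensional ℝ E] [FiniteDimensional ℝ F]

/-- One gradient step with exact line search, projected onto a subspace that contains `x`, under
restricted isometry bounds on the subspace and on the subspace enlarged by the target. -/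
theorem norm_projected_gradient_step_le {T : Module.End ℝ E} (hT : T.IsSymmetricProjection)
    (L : E →ₗ[ℝ] F) {x xs : E} (hx : T x = x) (ε : F) {R R' : ℝ} (hR0 : 0 ≤ R) (hR1 : R < 1)
    (hR' : 0 ≤ R')
    (hL : ∀ z, (1 - R) * ‖T z‖ ^ 2 ≤ ‖L (T z)‖ ^ 2 ∧ ‖L (T z)‖ ^ 2 ≤ (1 + R) * ‖T z‖ ^ 2)
    (hL' : ∀ (z : E) (c : ℝ),
      (1 - R') * ‖T z + c • (xs - T xs)‖ ^ 2 ≤ ‖L (T z + c • (xs - T xs))‖ ^ 2 ∧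
        ‖L (T z + c • (xs - T xs))‖ ^ 2 ≤ (1 + R') * ‖T z + c • (xs - T xs)‖ ^ 2)
    {G : E} (hG : G = T (LinearMap.adjoint L (L x - (L xs + ε)))) :
    ‖x - (‖G‖ ^ 2 / ‖L G‖ ^ 2) • G - xs‖ ≤ 2 * R / (1 - R) * ‖x - xs‖ +
      (1 + R' - R) / (1 - R) * ‖xs - T xs‖ + 1 / (1 - R) * ‖T (LinearMap.adjoint L ε)‖ := by
  have hR1' : 0 < 1 - R := sub_pos.mpr hR1
  have hTT : ∀ z, T (T z) = T z := fun z => by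
    rw [← Module.End.mul_apply, hT.isIdempotentElem.eq]
  -- Isometry at `G` puts the step size in `[1/(1+R), 1/(1-R)]`; for `G = 0` the step vanishes and
  -- `1` serves as a substitute.
  obtain ⟨α, hα, hα1, hα2⟩ : ∃ α : ℝ, (‖G‖ ^ 2 / ‖L G‖ ^ 2) • G = α • G ∧
      1 ≤ (1 + R) * α ∧ (1 - R) * α ≤ 1 := by
    rcases eq_or_ne G 0 with h0 | h0
    · exact ⟨1, by simp [h0], by linarith, by linarith⟩
    · have hGp : 0 < ‖G‖ ^ 2 := by positivity
      have h1 := hL G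
      rw [show T G = G by rw [hG, hTT]] at h1
      have h2 : 0 < ‖L G‖ ^ 2 := lt_of_lt_of_le (mul_pos hR1' hGp) h1.1
      refine ⟨_, rfl, ?_, ?_⟩
      · rw [← mul_div_assoc, le_div_iff₀ h2]
        linarith [h1.2]
      · rw [← mul_div_assoc, div_le_one h2]
        exact h1.1
  have hα0 : 0 < α := by
    by_contra hneg
    nlinarith
  have hα3 : α ≤ 1 / (1 - R) := by
    rw [le_div_iff₀ hR1']
    linarith
  set D := xs - T xs with hD
  have hTD : T D = 0 := by rw [hD, map_sub, hTT, sub_self]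
  set z := T (x - xs) with hz
  have hTz : T z = z := hTT _
  have hxz : x - xs = z - D := by
    rw [hz, hD, map_sub, hx]
    abel
  set w := z - α • T (LinearMap.adjoint L (L z)) with hw
  set v := T (LinearMap.adjoint L (L D)) with hv
  have hTw : T w = w := by rw [hw, map_sub, map_smul, hTz, hTT]
  have hTv : T v = v := hTT _
  have hadj : ∀ y u, T y = y → inner ℝ y (T (LinearMap.adjoint L (L u))) = inner ℝ (L y) (L u) := by
    intro y u hy
    rw [← hT.isSymmetric, hy, LinearMap.adjoint_inner_right]
  have hsplit : x - α • G - xs = w - D + α • v + α • T (LinearMap.adjoint L ε) := by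
    have h1 : L x - (L xs + ε) = L z - L D - ε := by
      rw [← map_sub, ← hxz, map_sub]
      abel
    rw [hG, h1, map_sub, map_sub, map_sub, map_sub, sub_right_comm, hxz, smul_sub, smul_sub, hw, hv]
    abel
  -- On the range of `T`, the form `‖y‖² - α ‖L y‖²` is at most `2R/(1-R) ‖y‖²` in absolute value,
  -- the worst case being `α = 1/(1-R)` with `‖L y‖² = (1+R) ‖y‖²`. Polarizing and testing with `w`,
  -- which lies in that range, bounds `‖w‖²`.
  have hw1 : ‖w‖ ≤ 2 * R / (1 - R) * ‖z‖ := by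
    have h1 : |1 * inner ℝ w z - α * inner ℝ (L w) (L z)| ≤ 2 * R / (1 - R) * (‖w‖ * ‖z‖) := by
      refine abs_inner_sub_inner_le L fun a b => ?_
      have h2 : T (a • w + b • z) = a • w + b • z := by
        rw [map_add, map_smul, map_smul, hTw, hTz]
      have h3 := hL (a • w + b • z)
      rw [h2] at h3
      set N := ‖a • w + b • z‖ ^ 2
      have hN : 0 ≤ N := sq_nonneg _
      set S := ‖L (a • w + b • z)‖ ^ 2
      have hS : 0 ≤ S := sq_nonneg _
      have hB : (1 - R) * (2 * R / (1 - R) * N) = 2 * R * N := by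
        field_simp
      have h4 := mul_le_mul_of_nonneg_right hα2 hS
      have h5 := mul_le_mul_of_nonneg_right hα1 hS
      rw [abs_le]
      constructor <;> refine le_of_mul_le_mul_left ?_ hR1'
      · linarith [h3.2]
      · rw [hB]
        rcases le_total (N - α * S) 0 with h6 | h6
        · nlinarith [mul_nonneg hR0 hN]
        · nlinarith [mul_nonneg hR0 h6, h3.1]
    rcases eq_or_ne w 0 with h0 | h0
    · rw [h0, norm_zero]
      positivity
    · have h2 : ‖w‖ ^ 2 = 1 * inner ℝ w z - α * inner ℝ (L w) (L z) := by
        rw [← real_inner_self_eq_norm_sq]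
        conv_lhs => rw [hw, inner_sub_right, inner_smul_right, ← hw, hadj w z hTw]
        ring
      refine le_of_mul_le_mul_left ?_ (norm_pos_iff.mpr h0)
      calc ‖w‖ * ‖w‖ = |1 * inner ℝ w z - α * inner ℝ (L w) (L z)| := by
            rw [← h2, abs_of_nonneg (sq_nonneg _), sq]
        _ ≤ _ := h1
        _ = _ := by ring
  -- `v` is tangent and `D` is normal, so `⟪v, D⟫ = 0` and isometry nearly preserves this; moreover
  -- `⟪L v, L D⟫ = ‖v‖²`.
  have hv1 : ‖v‖ ≤ R' * ‖D‖ := by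
    have h1 : |1 * inner ℝ v D - 1 * inner ℝ (L v) (L D)| ≤ R' * (‖v‖ * ‖D‖) := by
      refine abs_inner_sub_inner_le L fun a b => ?_
      have h3 := hL' (a • v) b
      rw [map_smul, hTv] at h3
      rw [abs_le]
      constructor <;> linarith [h3.1, h3.2]
    have h2 : inner ℝ v D = (0 : ℝ) := by
      rw [← hTv, hT.isSymmetric, hTD, inner_zero_right]
    rcases eq_or_ne v 0 with h0 | h0
    · rw [h0, norm_zero]
      positivity
    · refine le_of_mul_le_mul_left ?_ (norm_pos_iff.mpr h0)
      calc ‖v‖ * ‖v‖ = |1 * inner ℝ v D - 1 * inner ℝ (L v) (L D)| := by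
            rw [← hadj v D hTv, ← hv, h2, real_inner_self_eq_norm_sq, mul_zero, zero_sub, abs_neg,
              one_mul, abs_of_nonneg (sq_nonneg _), sq]
        _ ≤ _ := h1
        _ = _ := by ring
  have hz1 : ‖z‖ ≤ ‖x - xs‖ := by
    refine le_of_sq_le_sq ?_ (norm_nonneg _)
    nlinarith [LinearMap.IsSymmetricProjection.norm_sq hT (x - xs), sq_nonneg ‖x - xs - T (x - xs)‖]
  rw [hα, hsplit]
  have hc : 0 ≤ 2 * R / (1 - R) := by positivity
  calc _ ≤ ‖w‖ + ‖D‖ + ‖α • v‖ + ‖α • T (LinearMap.adjoint L ε)‖ :=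
        (norm_add_le _ _).trans (add_le_add_left
          ((norm_add_le _ _).trans (add_le_add_left (norm_sub_le _ _) _)) _)
    _ = ‖w‖ + ‖D‖ + α * ‖v‖ + α * ‖T (LinearMap.adjoint L ε)‖ := by
        rw [norm_smul, norm_smul, Real.norm_of_nonneg hα0.le]
    _ ≤ 2 * R / (1 - R) * ‖x - xs‖ + ‖D‖ + 1 / (1 - R) * (R' * ‖D‖) +
          1 / (1 - R) * ‖T (LinearMap.adjoint L ε)‖ := by
        gcongr
        exact hw1.trans (mul_le_mul_of_nonneg_left hz1 hc)
    _ = _ := by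
        field_simp
        ring

end ProjectedGradientStep

/-! ### Noise term, restricted isometry constants and the one-step recursion. -/

section Convergence

variable {s : ℕ} {p r : Fin s → ℕ}

theorem tuckerRank_smul_le (c : ℝ) (X : Tensor p) : tuckerRank (c • X) ≤ tuckerRank X := by
  intro k
  have h : matricize k (c • X) = (c • (1 : Matrix (Fin (p k)) (Fin (p k)) ℝ)) * matricize k X := by
    rw [Matrix.smul_mul, Matrix.one_mul]
    rfl
  rw [tuckerRank, h]
  exact Matrix.rank_mul_le_right _ _

theorem tuckerRank_add_le (X Y : Tensor p) (k : Fin s) :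
    tuckerRank (X + Y) k ≤ tuckerRank X k + tuckerRank Y k :=
  matrix_rank_add_le _ _

/-- Tensors of bounded Tucker rank form a cone, so no multiple of `B` approximates `Z` better than
`B`; hence `Z - B ⟂ B`. -/
theorem IsBestApprox.inner_eq {ρ : Fin s → ℕ} {Z B : Tensor p} (h : IsBestApprox ρ Z B) :
    inner ℝ Z B = ‖B‖ ^ 2 := by
  rcases eq_or_ne B 0 with rfl | hB
  · simp
  have hpos : 0 < ‖B‖ ^ 2 := by positivity
  set t : ℝ := inner ℝ Z B / ‖B‖ ^ 2 with ht
  have h1 := pow_le_pow_left₀ (norm_nonneg _)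
    (h.2 (t • B) ((tuckerRank_smul_le t B).trans h.1)) 2
  rw [norm_sub_sq_real, norm_sub_sq_real, norm_smul, inner_smul_right, mul_pow, Real.norm_eq_abs,
    sq_abs] at h1
  have h2 : inner ℝ Z B = t * ‖B‖ ^ 2 := by
    rw [ht]
    field_simp
  rw [h2] at h1 ⊢
  have h3 : (t - 1) ^ 2 * ‖B‖ ^ 2 ≤ 0 := by linarith
  have h4 : (t - 1) ^ 2 = 0 := le_antisymm (nonpos_of_mul_nonpos_left h3 hpos) (sq_nonneg _)
  have h5 : t = 1 := by linarith [pow_eq_zero_iff two_ne_zero |>.mp h4]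
  rw [h5, one_mul]

/-- `T Z` is a competitor of admissible rank, and by orthogonality both residuals have squared norm
`‖Z‖²` minus that of the approximation. -/
theorem norm_projection_le_maxApprox {ρ : Fin s → ℕ} {T : Module.End ℝ (Tensor p)}
    (hT : T.IsSymmetricProjection) (hρ : ∀ Z, tuckerRank (T Z) ≤ ρ) (Z : Tensor p) :
    ‖T Z‖ ≤ ‖maxApprox ρ Z‖ := by
  have hB : IsBestApprox ρ Z (maxApprox ρ Z) := (exists_isBestApprox ρ Z).choose_spec
  have h1 := pow_le_pow_left₀ (norm_nonneg _) (hB.2 _ (hρ Z)) 2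
  rw [hT.norm_sq, norm_sub_sq_real, hB.inner_eq] at h1
  exact le_of_sq_le_sq (by linarith) (norm_nonneg _)

theorem maxApprox_zero (ρ : Fin s → ℕ) : maxApprox ρ (0 : Tensor p) = 0 := by
  have h := ((exists_isBestApprox ρ (0 : Tensor p)).choose_spec).inner_eq
  rw [inner_zero_left] at h
  exact norm_eq_zero.mp (pow_eq_zero_iff two_ne_zero |>.mp h.symm)

variable {d m n : ℕ} {p r rstar : Fin (d + m) → ℕ}

/-- The infimum in the definition of the restricted isometry constant is attained. -/
theorem tripConst_spec (L : Tensor p →ₗ[ℝ] Response n p) {ρ : Fin (d + m) → ℕ} {Z : Tensor p}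
    (hZ : tuckerRank Z ≤ ρ) :
    (1 - tripConst L ρ) * ‖Z‖ ^ 2 ≤ ‖L Z‖ ^ 2 ∧ ‖L Z‖ ^ 2 ≤ (1 + tripConst L ρ) * ‖Z‖ ^ 2 := by
  rcases eq_or_ne Z 0 with rfl | h0
  · simp
  have hpos : 0 < ‖Z‖ ^ 2 := by positivity
  have hne : {R : ℝ | ∀ Z : Tensor p, tuckerRank Z ≤ ρ →
      (1 - R) * ‖Z‖ ^ 2 ≤ ‖L Z‖ ^ 2 ∧ ‖L Z‖ ^ 2 ≤ (1 + R) * ‖Z‖ ^ 2}.Nonempty := by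
    -- `1 + ‖L‖²` is an admissible constant, so the infimum is over a nonempty set.
    let L' := LinearMap.toContinuousLinearMap L
    refine ⟨1 + ‖L'‖ ^ 2, fun Z _ => ⟨?_, ?_⟩⟩
    · nlinarith [sq_nonneg ‖Z‖, sq_nonneg ‖L Z‖, mul_nonneg (sq_nonneg ‖L'‖) (sq_nonneg ‖Z‖)]
    · have h := pow_le_pow_left₀ (norm_nonneg _) (L'.le_opNorm Z) 2
      have h' : ‖L' Z‖ = ‖L Z‖ := rfl
      rw [h', mul_pow] at h
      nlinarith [sq_nonneg ‖Z‖]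
  have h1 : 1 - ‖L Z‖ ^ 2 / ‖Z‖ ^ 2 ≤ tripConst L ρ := by
    refine le_csInf hne fun R hR => ?_
    have := (hR Z hZ).1
    rw [← le_div_iff₀ hpos] at this
    linarith
  have h2 : ‖L Z‖ ^ 2 / ‖Z‖ ^ 2 - 1 ≤ tripConst L ρ := by
    refine le_csInf hne fun R hR => ?_
    have := (hR Z hZ).2
    rw [← div_le_iff₀ hpos] at this
    linarith
  rw [← le_div_iff₀ hpos, ← div_le_iff₀ hpos]
  constructor <;> linarith

theorem tripConst_nonneg (L : Tensor p →ₗ[ℝ] Response n p) {ρ : Fin (d + m) → ℕ} {Z : Tensor p}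
    (hZ : tuckerRank Z ≤ ρ) (h0 : Z ≠ 0) : 0 ≤ tripConst L ρ := by
  have hpos : 0 < ‖Z‖ ^ 2 := by positivity
  have h := tripConst_spec L hZ
  by_contra hneg
  nlinarith [h.1, h.2]

theorem IsRGDStep.tuckerRank_le {L : Tensor p →ₗ[ℝ] Response n p} {Y : Response n p}
    {X X' : Tensor p} (h : IsRGDStep L Y r X X') : tuckerRank X' ≤ r := by
  obtain ⟨U, V, G, Xhalf, -, -, -, h | h⟩ := h
  exacts [h.tuckerRank_le, h.tuckerRank_le]

/-- The one-step error recursion of Riemannian gradient descent. -/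
theorem IsRGDStep.norm_sub_le {L : Tensor p →ₗ[ℝ] Response n p} {E : Response n p}
    {X X' Xs : Tensor p} (h : IsRGDStep L (L Xs + E) r X X') (hX : tuckerRank X ≤ r)
    (hXs : tuckerRank Xs = rstar) (hXs0 : Xs ≠ 0) (hr : rstar ≤ r) {lam R R' : ℝ} (hlam : 0 < lam)
    (hle : ∀ k, lam ≤ sigma (matricize k Xs) (rstar k))
    (hR : R = tripConst L (fun k => 2 * r k))
    (hR' : R' = tripConst L (fun k => 2 * r k + rstar k)) (hR0 : 0 ≤ R) (hR1 : R < 1) :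
    ‖X' - Xs‖ ≤ (√((d + m : ℕ) : ℝ) + 1) * (2 * R / (1 - R) * ‖X - Xs‖ +
      (1 + R' - R) / (1 - R) * (((d + m : ℕ) : ℝ) * ‖X - Xs‖ ^ 2 / lam) +
      1 / (1 - R) * ‖maxApprox (fun k => 2 * r k) (LinearMap.adjoint L E)‖) := by
  obtain ⟨U, V, G, Xhalf, hF, hG, hhalf, hH⟩ := h
  have hT := tangentEnd_isSymmetricProjection hF.orthonormal_left hF.orthonormal_right
  have hrank : ∀ Z, tuckerRank (tangentEnd U V Z) ≤ fun k => 2 * r k :=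
    tuckerRank_tangentEnd_le hF.orthonormal_left
  have hR'0 : 0 ≤ R' := by
    rw [hR']
    exact tripConst_nonneg L (hXs.le.trans fun k => Nat.le_add_left _ _) hXs0
  have hrank' : ∀ (Z : Tensor p) (c : ℝ), tuckerRank (tangentEnd U V Z +
      c • (Xs - tangentEnd U V Xs)) ≤ fun k => 2 * r k + rstar k := by
    intro Z c k
    -- Regrouping leaves one tangent tensor plus a multiple of `Xs`, of rank at most `2r + r*`;
    -- bounding the summands separately would count the tangent rank twice.
    have h1 : tangentEnd U V Z + c • (Xs - tangentEnd U V Xs) =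
        tangentEnd U V (Z - c • Xs) + c • Xs := by
      rw [map_sub, map_smul, smul_sub]
      abel
    rw [h1]
    refine (tuckerRank_add_le _ _ k).trans (add_le_add (hrank _ k) ?_)
    rw [← hXs]
    exact tuckerRank_smul_le c Xs k
  rw [← tangentEnd_apply] at hG
  have hstep := norm_projected_gradient_step_le hT L (hF.tangentEnd_self hX) E hR0 hR1 hR'0
    (fun Z => by rw [hR]; exact tripConst_spec L (hrank Z))
    (fun Z c => by rw [hR']; exact tripConst_spec L (hrank' Z c)) hG
  rw [← hhalf] at hstep
  have hnorm : ‖Xs - tangentEnd U V Xs‖ ≤ ((d + m : ℕ) : ℝ) * ‖X - Xs‖ ^ 2 / lam := by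
    rw [le_div_iff₀ hlam, mul_comm]
    refine hF.norm_normal_le hX Xs hlam.le fun k => ?_
    have := hle k
    rwa [← congrFun hXs k] at this
  have hquasi : ‖Xhalf - X'‖ ≤ √((d + m : ℕ) : ℝ) * ‖Xhalf - Xs‖ := by
    rcases hH with hH | hH
    exacts [hH.norm_sub_le Xs (hXs.le.trans hr), hH.norm_sub_le Xs (hXs.le.trans hr)]
  have hnoise := norm_projection_le_maxApprox hT hrank (LinearMap.adjoint L E)
  have hR1' : 0 < 1 - R := sub_pos.mpr hR1
  have hR2 : 0 ≤ 1 + R' - R := by linarith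
  calc ‖X' - Xs‖ = ‖(Xhalf - Xs) - (Xhalf - X')‖ := by congr 1; abel
    _ ≤ ‖Xhalf - Xs‖ + ‖Xhalf - X'‖ := _root_.norm_sub_le _ _
    _ ≤ (√((d + m : ℕ) : ℝ) + 1) * ‖Xhalf - Xs‖ := by linarith
    _ ≤ _ := by
        refine mul_le_mul_of_nonneg_left (hstep.trans ?_) (by positivity)
        gcongr

end Convergence

end

/-! ### Assembly: the basin of attraction and the geometric series. -/

theorem mainTheorem1 (d m n : ℕ) (hdm : 0 < d + m) (p : Fin (d + m) → ℕ)
    (A : Fin n → Covariate p) (Xstar : Tensor p) (E Y : Response n p)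
    (hY : Y = regMap A Xstar + E)
    (rstar r : Fin (d + m) → ℕ)
    (hrank : tuckerRank Xstar = rstar) (hpos : ∀ k, 1 ≤ rstar k) (hr : rstar ≤ r)
    (X : ℕ → Tensor p) (hX : IsRGDRun (regMap A) Y r X)
    (R R' lam : ℝ)
    (hR : R = tripConst (regMap A) (fun k => 2 * r k))
    (hR' : R' = tripConst (regMap A) (fun k => 2 * r k + rstar k))
    (hlam : lam = minSigma rstar Xstar)
    (noise : ℝ)
    (hnoise : noise = ‖maxApprox (fun k => 2 * r k) (LinearMap.adjoint (regMap A) E)‖)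
    (htrip : SatisfiesTRIP (regMap A) (fun k => 2 * r k))
    (hinit : ‖X 0 - Xstar‖ ≤ R / (((d + m : ℕ) : ℝ) * (1 + R' - R)) * lam)
    (hRle : R ≤ 1 / (8 * (√((d + m : ℕ) : ℝ) + 1) + 1))
    (hsignal : 2 * (1 + R' - R) * (√((d + m : ℕ) : ℝ) + 1) * ((d + m : ℕ) : ℝ) * noise
      ≤ R * (1 - R) * lam) :
    (∀ t : ℕ, ‖X t - Xstar‖ ≤ (2 : ℝ)⁻¹ ^ t * ‖X 0 - Xstar‖
      + 2 * (√((d + m : ℕ) : ℝ) + 1) / (1 - R) * noise) ∧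
    (E = 0 → ∀ t : ℕ, ‖X t - Xstar‖ ≤ (2 : ℝ)⁻¹ ^ t * ‖X 0 - Xstar‖) := by
  have : Nonempty (Fin (d + m)) := ⟨⟨0, hdm⟩⟩
  have hR0 : 0 ≤ R := hR ▸ htrip.1
  have hR1 : R < 1 := hR ▸ htrip.2
  have hR1' : 0 < 1 - R := sub_pos.mpr hR1
  have hXs0 : Xstar ≠ 0 := by
    rintro rfl
    have h1 := hpos ⟨0, hdm⟩
    have h2 : matricize (⟨0, hdm⟩ : Fin (d + m)) (0 : Tensor p) = 0 := rfl
    rw [← hrank, tuckerRank, h2, Matrix.rank_zero] at h1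
    omega
  have hR'0 : 0 ≤ R' := by
    rw [hR']
    exact tripConst_nonneg _ (hrank.le.trans fun k => Nat.le_add_left _ _) hXs0
  have hle : ∀ k, lam ≤ sigma (matricize k Xstar) (rstar k) := fun k => by
    rw [hlam]
    exact ciInf_le (Set.finite_range _).bddBelow k
  have hlam0 : 0 < lam := by
    obtain ⟨k, hk⟩ := exists_eq_ciInf_of_finite (f := fun k => sigma (matricize k Xstar) (rstar k))
    rw [hlam, minSigma, ← hk]
    have h1 := hpos k
    rw [← hrank] at h1 ⊢
    exact sigma_rank_pos _ h1
  have hrk : ∀ t, tuckerRank (X t) ≤ r := by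
    rintro (_ | t)
    exacts [hX.1.le, (hX.2 t).tuckerRank_le]
  have hnoise0 : 0 ≤ noise := hnoise ▸ norm_nonneg _
  have hs0 : (0 : ℝ) < ((d + m : ℕ) : ℝ) := by exact_mod_cast hdm
  set q := √((d + m : ℕ) : ℝ) + 1 with hq
  have hq0 : 0 < q := by positivity
  have hRR : 0 < 1 + R' - R := by linarith
  -- `C` is the coefficient of the quadratic term and `N` the noise per step. The initialization
  -- condition reads `C * ‖X 0 - Xstar‖ ≤ R` and the signal condition `C * (2 * N) ≤ R`; they add up
  -- to the invariant `C * ‖X t - Xstar‖ ≤ 2 * R`.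
  set C := ((d + m : ℕ) : ℝ) * (1 + R' - R) / lam with hC
  have hC0 : 0 < C := by positivity
  set N := q / (1 - R) * noise with hN
  have hN0 : 0 ≤ N := by positivity
  have hCinit : C * ‖X 0 - Xstar‖ ≤ R := by
    calc C * ‖X 0 - Xstar‖ ≤ C * (R / (((d + m : ℕ) : ℝ) * (1 + R' - R)) * lam) :=
          mul_le_mul_of_nonneg_left hinit hC0.le
      _ = R := by
        rw [hC]
        field_simp
  have hCN : C * (2 * N) ≤ R := by
    have h1 : C * (2 * N) = 2 * (1 + R' - R) * q * ((d + m : ℕ) : ℝ) * noise / ((1 - R) * lam) := by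
      rw [hC, hN]
      field_simp
    rw [h1, div_le_iff₀ (by positivity)]
    linarith
  -- This is `R ≤ 1 / (8 * q + 1)` rearranged. The `4 * R` is `2 * R` from the linear term plus at
  -- most `2 * R` from `C * ‖X t - Xstar‖`.
  have hcontr : q * (4 * R / (1 - R)) ≤ 1 / 2 := by
    rw [le_div_iff₀ (by positivity)] at hRle
    rw [← mul_div_assoc, div_le_iff₀ hR1']
    linarith
  have hrec : ∀ t, C * ‖X t - Xstar‖ ≤ 2 * R →
      ‖X (t + 1) - Xstar‖ ≤ 2⁻¹ * ‖X t - Xstar‖ + N := by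
    intro t ht
    have hstep := hX.2 t
    rw [hY] at hstep
    have h1 := hstep.norm_sub_le (hrk t) hrank hXs0 hr hlam0 hle hR hR' hR0 hR1
    rw [← hnoise, ← hq] at h1
    set e := ‖X t - Xstar‖
    have he : 0 ≤ e := norm_nonneg _
    have h2 : q * (2 * R / (1 - R) * e + (1 + R' - R) / (1 - R) *
        (((d + m : ℕ) : ℝ) * e ^ 2 / lam) + 1 / (1 - R) * noise) =
        q / (1 - R) * ((2 * R + C * e) * e) + N := by
      rw [hC, hN]
      field_simp
    rw [h2] at h1
    refine h1.trans (add_le_add_left ?_ N)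
    calc q / (1 - R) * ((2 * R + C * e) * e) ≤ q / (1 - R) * ((2 * R + 2 * R) * e) := by gcongr
      _ = q * (4 * R / (1 - R)) * e := by ring
      _ ≤ 1 / 2 * e := mul_le_mul_of_nonneg_right hcontr he
      _ = _ := by ring
  -- `2 * N` is the fixed point of `x ↦ x / 2 + N`. The bound at `t` itself yields the invariant
  -- needed for the next step.
  have hmain : ∀ t : ℕ, ‖X t - Xstar‖ ≤ (2 : ℝ)⁻¹ ^ t * ‖X 0 - Xstar‖ + 2 * N := by
    intro t
    induction t with
    | zero => simpa using hN0
    | succ t ih =>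
      have h1 : (2 : ℝ)⁻¹ ^ t * ‖X 0 - Xstar‖ ≤ ‖X 0 - Xstar‖ :=
        mul_le_of_le_one_left (norm_nonneg _) (pow_le_one₀ (by norm_num) (by norm_num))
      have h2 : C * ‖X t - Xstar‖ ≤ 2 * R := by
        have := mul_le_mul_of_nonneg_left (ih.trans (add_le_add_left h1 _)) hC0.le
        rw [mul_add] at this
        linarith
      have h3 := hrec t h2
      rw [pow_succ]
      linarith
  have hNeq : 2 * q / (1 - R) * noise = 2 * N := by
    rw [hN]
    ring
  refine ⟨fun t => ?_, fun hE t => ?_⟩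
  · rw [hNeq]
    exact hmain t
  · have h0 : noise = 0 := by
      rw [hnoise, hE, map_zero, maxApprox_zero, norm_zero]
    have := hmain t
    rwa [hN, h0, mul_zero, mul_zero, add_zero] at this
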